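/- Let $\Bbbk$ be a field containing a primitive $d$-th root of unity $\zeta$, where $d\ge 2$, and put $S_1=\Bbbk[[x_1,\dots,x_a]]$, $S_2=\Bbbk[[y_1,\dots,y_b]]$, $S=\Bbbk[[x_1,\dots,x_a,y_1,\dots,y_b]]$. For a commutative ring $Q$ and $f\in Q$, let $\mathrm{MF}^d_Q(f)$ be the category of $d$-fold matrix factorizations of $f$: finitely generated projective $\mathbb{Z}/d$-graded $Q$-modules $X=\bigoplus_{k\in\mathbb{Z}/d}X_k$ with a $Q$-linear map $\varphi:X\to X$ of degree $-1$ such that $\varphi^d=f\cdot 1_X$; morphisms are the $Q$-linear maps of degree $0$ which commute with the maps $\varphi$. We write $X=(\varphi_1,\varphi_2,\dots,\varphi_{d-1},\varphi_0)$ with $\varphi_k:X_k\to X_{k-1}$ the restriction of $\varphi$. The shift $T^iX$ has $(T^iX)_k=X_{k+i}$ and the same map $\varphi$. If $Q$ is local with maximal ideal $\mathfrak n$, then $X$ is called reduced if $\varphi_k(X_k)\subseteq\mathfrak n X_{k-1}$ for all $k$. A nonzero factorization is called indecomposable if it is not isomorphic to a direct sum of two nonzero factorizations. For $X\in\mathrm{MF}^d_{S_1}(f)$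 and $Y\in\mathrm{MF}^d_{S_2}(g)$ with structure maps $\varphi$ and $\psi$, the tensor product $X\otimes Y\in\mathrm{MF}^d_S(f+g)$ is formed after extending scalars to $S$: its degree $k$ part is $\bigoplus_{i+j=k}X_i\otimes_S Y_j$, and its structure map is $x\otimes y\mapsto\varphi(x)\otimes y+\zeta^{|x|}x\otimes\psi(y)$ for homogeneous $x$ of degree $|x|$. **Theorem.** Let $f\in S_1$ be nonzero and non-invertible. Let $u_1,u_2,\dots,u_{d-1},u_0$ be nonzero elements of the maximal ideal of $S_2$, and let $Y=(u_1,u_2,\dots,u_{d-1},u_0)\in\mathrm{MF}^d_{S_2}(u_1u_2\cdots u_{d-1}u_0)$ be the corresponding (reduced) factorization of rank one, with $Y_k=S_2$ for all $k$. Let $X\in\mathrm{MF}^d_{S_1}(f)$ be reduced and indecomposable, and suppose that $T^iX\not\cong X$ for all $i\ne 0$ in $\mathbb{Z}/d$. Then $X\otimes Y$ is indecomposable. -/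

import Mathlib

open scoped TensorProduct

universe u

/-! ### Graded modules, described by their projections -/

namespace GradedAux

/-- A family of submodules is an internal direct sum decomposition as soon as there is a
compatible family of projections. -/
theorem isInternal_of_proj {R M ι : Type*} [CommRing R] [AddCommGroup M] [Module R M]
    [Fintype ι] [DecidableEq ι] (A : ι → Submodule R M) (p : ι → M →ₗ[R] M)
    (h1 : ∀ i x, p i x ∈ A i) (h2 : ∀ i, ∀ x ∈ A i, p i x = x)
    (h3 : ∀ i j, i ≠ j → ∀ x ∈ A j, p i x = 0) (h4 : ∀ x, ∑ i, p i x = x) :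
    DirectSum.IsInternal A := by
  refine DirectSum.isInternal_submodule_of_iSupIndep_of_iSup_eq_top ?_ ?_
  · intro i
    rw [Submodule.disjoint_def]
    intro x hx hx'
    have hle : (⨆ j, ⨆ (_ : j ≠ i), A j) ≤ LinearMap.ker (p i) :=
      iSup_le fun j => iSup_le fun hj x hx => h3 i j hj.symm x hx
    rw [← h2 i x hx]
    exact hle hx'
  · rw [eq_top_iff]
    intro x _
    rw [← h4 x]
    exact Submodule.sum_mem _ fun i _ => Submodule.mem_iSup_of_mem i (h1 i x)

theorem bijective_coe {R M ι : Type*} [CommRing R] [AddCommGroup M] [Module R M]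
    [DecidableEq ι] {A : ι → Submodule R M} (hA : DirectSum.IsInternal A) :
    Function.Bijective (DirectSum.coeLinearMap A) := hA

/-- The linear endomorphism of an internally graded module which multiplies the homogeneous
elements of degree `i` by `c i`. -/
noncomputable def scale {R M ι : Type*} [CommRing R] [AddCommGroup M] [Module R M]
    [DecidableEq ι] {A : ι → Submodule R M} (hA : DirectSum.IsInternal A) (c : ι → R) :
    M →ₗ[R] M :=
  (DirectSum.toModule R ι M fun i => c i • (A i).subtype) ∘ₗ
    (LinearEquiv.ofBijective (DirectSum.coeLinearMap A) (bijective_coe hA)).symm.toLinearMap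

theorem scale_apply {R M ι : Type*} [CommRing R] [AddCommGroup M] [Module R M]
    [DecidableEq ι] {A : ι → Submodule R M} (hA : DirectSum.IsInternal A) (c : ι → R)
    {i : ι} {x : M} (hx : x ∈ A i) : scale hA c x = c i • x := by
  have : (LinearEquiv.ofBijective (DirectSum.coeLinearMap A) (bijective_coe hA)).symm x
      = DirectSum.lof R ι (fun i => A i) i ⟨x, hx⟩ := by
    rw [LinearEquiv.symm_apply_eq]
    simp
  simp [scale, this]

theorem ext_of_homogeneous {R M N ι : Type*} [CommRing R] [AddCommGroup M] [Module R M]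
    [AddCommGroup N] [Module R N]
    [DecidableEq ι] {A : ι → Submodule R M} (hA : DirectSum.IsInternal A)
    {F G : M →ₗ[R] N} (h : ∀ i, ∀ x ∈ A i, F x = G x) : F = G := by
  have hle : (⨆ i, A i) ≤ LinearMap.eqLocus F G := iSup_le fun i x hx => h i x hx
  rw [hA.submodule_iSup_eq_top] at hle
  ext x
  exact hle trivial

theorem scale_eq_of_const {R M ι : Type*} [CommRing R] [AddCommGroup M] [Module R M]
    [DecidableEq ι] {A : ι → Submodule R M} (hA : DirectSum.IsInternal A) :
    scale hA (fun _ => (1 : R)) = LinearMap.id :=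
  ext_of_homogeneous hA fun i x hx => by simp [scale_apply hA _ hx]

theorem scale_mem {R M ι : Type*} [CommRing R] [AddCommGroup M] [Module R M]
    [DecidableEq ι] {A : ι → Submodule R M} (hA : DirectSum.IsInternal A) (c : ι → R)
    {i : ι} {x : M} (hx : x ∈ A i) : scale hA c x ∈ A i := by
  rw [scale_apply hA c hx]
  exact (A i).smul_mem _ hx

theorem scale_pow {R M ι : Type*} [CommRing R] [AddCommGroup M] [Module R M]
    [DecidableEq ι] {A : ι → Submodule R M} (hA : DirectSum.IsInternal A) (c : ι → R) (n : ℕ) :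
    scale hA c ^ n = scale hA fun i => c i ^ n := by
  refine ext_of_homogeneous hA fun i x hx => ?_
  rw [scale_apply hA _ hx]
  induction n with
  | zero => simp
  | succ n ih =>
    rw [pow_succ', Module.End.mul_apply, ih, map_smul, scale_apply hA _ hx, smul_smul, pow_succ]

/-- The projection onto the degree `i` part. -/
noncomputable def proj {R M ι : Type*} [CommRing R] [AddCommGroup M] [Module R M]
    [DecidableEq ι] {A : ι → Submodule R M} (hA : DirectSum.IsInternal A) (i : ι) :
    M →ₗ[R] M :=
  scale hA fun j => if j = i then 1 else 0

section proj

variable {R M ι : Type*} [CommRing R] [AddCommGroup M] [Module R M]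
    [DecidableEq ι] {A : ι → Submodule R M} (hA : DirectSum.IsInternal A)

theorem proj_same {i : ι} {x : M} (hx : x ∈ A i) : proj hA i x = x := by
  simp [proj, scale_apply hA _ hx]

theorem proj_ne {i j : ι} (h : i ≠ j) {x : M} (hx : x ∈ A j) : proj hA i x = 0 := by
  simp [proj, scale_apply hA _ hx, h.symm]

theorem proj_mem (i : ι) (x : M) : proj hA i x ∈ A i := by
  have hle : (⨆ i, A i) ≤ (A i).comap (proj hA i) := iSup_le fun j x hx => by
    rw [Submodule.mem_comap]
    by_cases h : i = j
    · subst h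
      rwa [proj_same hA hx]
    · rw [proj_ne hA h hx]
      exact zero_mem _
  rw [hA.submodule_iSup_eq_top] at hle
  exact hle trivial

theorem sum_proj [Fintype ι] (x : M) : ∑ i, proj hA i x = x := by
  have : ∑ i, proj hA i = LinearMap.id := ext_of_homogeneous hA fun j x hx => by
    rw [LinearMap.sum_apply, Finset.sum_eq_single j]
    · simp [proj_same hA hx]
    · intro i _ hij
      exact proj_ne hA hij hx
    · simp
  simpa using LinearMap.congr_fun this x

end proj

/-- Gaussian binomial coefficients at `q`, through the Pascal rule. -/
def qbinom {R : Type*} [CommRing R] (q : R) : ℕ → ℕ → R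
  | _, 0 => 1
  | 0, _ + 1 => 0
  | n + 1, i + 1 => qbinom q n (i + 1) + q ^ (n - i) * qbinom q n i

theorem qbinom_eq_zero {R : Type*} [CommRing R] (q : R) : ∀ n i : ℕ, n < i → qbinom q n i = 0
  | _, 0, h => absurd h (by omega)
  | 0, _ + 1, _ => rfl
  | n + 1, i + 1, h => by
    rw [qbinom, qbinom_eq_zero q n (i + 1) (by omega), qbinom_eq_zero q n i (by omega)]
    simp

theorem qbinom_self {R : Type*} [CommRing R] (q : R) : ∀ n : ℕ, qbinom q n n = 1
  | 0 => rfl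
  | n + 1 => by
    rw [qbinom, qbinom_eq_zero q n (n + 1) (by omega), qbinom_self q n]
    simp

theorem qbinom_mul {R : Type*} [CommRing R] (q : R) : ∀ n i : ℕ,
    qbinom q n i * ∏ j ∈ Finset.range i, (q ^ (j + 1) - 1)
      = ∏ j ∈ Finset.range i, (q ^ (n - j) - 1)
  | n, 0 => by simp [qbinom]
  | 0, i + 1 => by
    rw [qbinom, zero_mul, Finset.prod_range_succ']
    simp
  | n + 1, i + 1 => by
    have h1 := qbinom_mul q n (i + 1)
    have h2 := qbinom_mul q n i
    rw [qbinom, add_mul, h1]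
    have h3 : q ^ (n - i) * qbinom q n i * ∏ j ∈ Finset.range (i + 1), (q ^ (j + 1) - 1)
        = q ^ (n - i) * (∏ j ∈ Finset.range i, (q ^ (n - j) - 1)) * (q ^ (i + 1) - 1) := by
      rw [Finset.prod_range_succ, ← h2]
      ring
    rw [h3, Finset.prod_range_succ, Finset.prod_range_succ']
    have h4 : ∏ j ∈ Finset.range i, (q ^ (n + 1 - (j + 1)) - 1)
        = ∏ j ∈ Finset.range i, (q ^ (n - j) - 1) :=
      Finset.prod_congr rfl fun j _ => by rw [Nat.add_sub_add_right]
    rw [h4]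
    rcases Nat.lt_or_ge n i with h | h
    · have : ∏ j ∈ Finset.range i, (q ^ (n - j) - 1) = 0 :=
        Finset.prod_eq_zero (Finset.mem_range.mpr h) (by simp)
      simp [this]
    · have : q ^ (n + 1 - 0) = q ^ (n - i) * q ^ (i + 1) := by
        rw [← pow_add]; congr 1; omega
      rw [this]
      ring

theorem qbinom_primitiveRoot {R : Type*} [CommRing R] [NoZeroDivisors R] {q : R} {d : ℕ}
    (hq : IsPrimitiveRoot q d) {i : ℕ} (h0 : 0 < i) (hi : i < d) : qbinom q d i = 0 := by
  rcases subsingleton_or_nontrivial R with _ | _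
  · exact Subsingleton.elim _ _
  have h := qbinom_mul q d i
  have hz : ∏ j ∈ Finset.range i, (q ^ (d - j) - 1) = 0 :=
    Finset.prod_eq_zero (Finset.mem_range.mpr h0) (by simp [hq.pow_eq_one])
  rw [hz] at h
  refine (mul_eq_zero.mp h).resolve_right (Finset.prod_ne_zero_iff.mpr fun j hj => ?_)
  rw [Finset.mem_range] at hj
  exact sub_ne_zero.mpr (hq.pow_ne_one_of_pos_of_lt (by omega) (by omega))

theorem add_pow_qcomm {R E : Type*} [CommRing R] [Ring E] [Algebra R E] (q : R) (A B : E)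
    (h : A * B = q • (B * A)) (n : ℕ) :
    (A + B) ^ n = ∑ i ∈ Finset.range (n + 1), qbinom q n i • (B ^ i * A ^ (n - i)) := by
  have hAB : ∀ m : ℕ, A ^ m * B = q ^ m • (B * A ^ m) := by
    intro m
    induction m with
    | zero => simp
    | succ m ih =>
      rw [pow_succ', mul_assoc, ih, mul_smul_comm, ← mul_assoc, h, smul_mul_assoc, smul_smul,
        mul_assoc, ← pow_succ]
  induction n with
  | zero => simp [qbinom]
  | succ n ih =>
    have e1 : (A + B) ^ (n + 1)
        = ∑ i ∈ Finset.range (n + 1), qbinom q n i • (B ^ i * A ^ (n + 1 - i))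
          + ∑ i ∈ Finset.range (n + 1),
            (q ^ (n - i) * qbinom q n i) • (B ^ (i + 1) * A ^ (n - i)) := by
      rw [pow_succ, ih, Finset.sum_mul, ← Finset.sum_add_distrib]
      refine Finset.sum_congr rfl fun i hi => ?_
      rw [Finset.mem_range] at hi
      rw [smul_mul_assoc, mul_add, mul_assoc, mul_assoc, hAB, ← pow_succ,
        show n - i + 1 = n + 1 - i by omega, smul_add, mul_smul_comm, smul_smul, ← mul_assoc,
        ← pow_succ, mul_comm (q ^ (n - i))]
    rw [e1, Finset.sum_range_succ' _ (n + 1), Finset.sum_range_succ' _ n]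
    have e2 : ∑ i ∈ Finset.range (n + 1),
          qbinom q (n + 1) (i + 1) • (B ^ (i + 1) * A ^ (n + 1 - (i + 1)))
        = ∑ i ∈ Finset.range n, qbinom q n (i + 1) • (B ^ (i + 1) * A ^ (n - i))
          + ∑ i ∈ Finset.range (n + 1),
            (q ^ (n - i) * qbinom q n i) • (B ^ (i + 1) * A ^ (n - i)) := by
      have e3 : ∑ i ∈ Finset.range n, qbinom q n (i + 1) • (B ^ (i + 1) * A ^ (n - i))
          = ∑ i ∈ Finset.range (n + 1),
            qbinom q n (i + 1) • (B ^ (i + 1) * A ^ (n - i)) := by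
        rw [Finset.sum_range_succ, qbinom_eq_zero q n (n + 1) (by omega)]
        simp
      rw [e3, ← Finset.sum_add_distrib]
      refine Finset.sum_congr rfl fun i _ => ?_
      rw [qbinom, add_smul, Nat.add_sub_add_right]
    rw [e2]
    have e4 : qbinom q n 0 = 1 := by cases n <;> rfl
    have e5 : qbinom q (n + 1) 0 = 1 := rfl
    simp only [Nat.add_sub_add_right, e4, e5]
    abel

/-- If `A B = q B A` for a primitive `d`-th root of unity `q`, then `(A + B)^d = A^d + B^d`. -/
theorem add_pow_primitiveRoot {R E : Type*} [CommRing R] [NoZeroDivisors R] [Ring E]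
    [Algebra R E] {q : R} {d : ℕ} [NeZero d] (hq : IsPrimitiveRoot q d) (A B : E)
    (h : A * B = q • (B * A)) : (A + B) ^ d = A ^ d + B ^ d := by
  have hd : 0 < d := Nat.pos_of_ne_zero (NeZero.ne d)
  have h0 : qbinom q d 0 = 1 := by cases d <;> rfl
  rw [add_pow_qcomm q A B h d, Finset.sum_range_succ, qbinom_self]
  obtain ⟨m, rfl⟩ : ∃ m, d = m + 1 := ⟨d - 1, by omega⟩
  rw [Finset.sum_range_succ', Finset.sum_eq_zero]
  · simp [h0]
  · intro i hi
    rw [Finset.mem_range] at hi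
    rw [qbinom_primitiveRoot hq (by omega) (by omega), zero_smul]

end GradedAux

/-! ### Matrix factorizations -/

/-- A matrix factorization of `f : Q` with `d` factors: a finitely generated projective
`Q`-module `X` with an internal direct sum decomposition `X = ⨁ k, X_k` indexed by
`ZMod d`, together with an endomorphism `φ` of degree `-1` such that `φ ^ d = f · 1_X`.
(As the direct sum is finite, `X` is finitely generated projective if and only if every `X_k`
is, and the maps `φ_k : X_k → X_{k-1}` are the restrictions of `φ`.) -/
structure MatFac {Q : Type u} [CommRing Q] (d : ℕ) (f : Q) : Type (u + 1) where
  /-- the underlying module -/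
  carrier : Type u
  [instAddCommGroup : AddCommGroup carrier]
  [instModule : Module Q carrier]
  [instFinite : Module.Finite Q carrier]
  [instProjective : Module.Projective Q carrier]
  /-- the homogeneous components -/
  gr : ZMod d → Submodule Q carrier
  /-- the structure map -/
  map : carrier →ₗ[Q] carrier
  isInternal : DirectSum.IsInternal gr
  map_mem : ∀ k, ∀ x ∈ gr k, map x ∈ gr (k - 1)
  map_pow : map ^ d = f • LinearMap.id

namespace MatFac

attribute [instance] MatFac.instAddCommGroup MatFac.instModule MatFac.instFinite
  MatFac.instProjective

variable {Q : Type u} [CommRing Q] {d : ℕ}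

/-- `X ≅ X'`: there is a linear isomorphism of degree zero which commutes with the structure
maps. -/
def Iso {f : Q} (X X' : MatFac d f) : Prop :=
  ∃ e : X.carrier ≃ₗ[Q] X'.carrier,
    (∀ k, (X.gr k).map e.toLinearMap = X'.gr k) ∧ ∀ x, e (X.map x) = X'.map (e x)

/-- The zero object. -/
def IsZero {f : Q} (X : MatFac d f) : Prop := Subsingleton X.carrier

/-- The shift `T^i X`, with `(T^i X)_k = X_{k+i}` and the same structure map. -/
def shift [NeZero d] {f : Q} (X : MatFac d f) (i : ZMod d) : MatFac d f where
  carrier := X.carrier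
  gr k := X.gr (k + i)
  map := X.map
  isInternal := by
    refine GradedAux.isInternal_of_proj _ (fun k => GradedAux.proj X.isInternal (k + i)) ?_ ?_ ?_ ?_
    · intro k x
      exact GradedAux.proj_mem _ _ _
    · intro k x hx
      exact GradedAux.proj_same _ hx
    · intro k j hkj x hx
      exact GradedAux.proj_ne _ (fun h => hkj (add_right_cancel h)) hx
    · intro x
      exact (Equiv.sum_comp (Equiv.addRight i) fun k => GradedAux.proj X.isInternal k x).trans
        (GradedAux.sum_proj X.isInternal x)
  map_mem k x hx := by
    have := X.map_mem (k + i) x hx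
    rwa [show k + i - 1 = k - 1 + i by ring] at this
  map_pow := X.map_pow

/-- The direct sum of two matrix factorizations of `f`. -/
def directSum [NeZero d] {f : Q} (X Y : MatFac d f) : MatFac d f where
  carrier := X.carrier × Y.carrier
  gr k := (X.gr k).prod (Y.gr k)
  map := X.map.prodMap Y.map
  isInternal := by
    refine GradedAux.isInternal_of_proj _
      (fun k => (GradedAux.proj X.isInternal k).prodMap (GradedAux.proj Y.isInternal k)) ?_ ?_ ?_ ?_
    · intro k x
      exact ⟨GradedAux.proj_mem X.isInternal k x.1, GradedAux.proj_mem Y.isInternal k x.2⟩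
    · intro k x hx
      exact Prod.ext (GradedAux.proj_same X.isInternal hx.1) (GradedAux.proj_same Y.isInternal hx.2)
    · intro k j hkj x hx
      exact Prod.ext (GradedAux.proj_ne X.isInternal hkj hx.1) (GradedAux.proj_ne Y.isInternal hkj hx.2)
    · intro x
      refine Prod.ext ?_ ?_
      · simp [Prod.fst_sum, GradedAux.sum_proj]
      · simp [Prod.snd_sum, GradedAux.sum_proj]
  map_mem k x hx := ⟨X.map_mem k _ hx.1, Y.map_mem k _ hx.2⟩
  map_pow := by
    have h : ∀ n : ℕ, (X.map.prodMap Y.map) ^ n = (X.map ^ n).prodMap (Y.map ^ n) := by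
      intro n
      induction n with
      | zero => rfl
      | succ n ih =>
        rw [pow_succ, ih, pow_succ, pow_succ, LinearMap.prodMap_mul]
    rw [h, X.map_pow, Y.map_pow]
    rfl

/-- A nonzero matrix factorization is indecomposable if it is not isomorphic to a direct sum of
two nonzero matrix factorizations. -/
def Indecomposable [NeZero d] {f : Q} (X : MatFac d f) : Prop :=
  ¬ X.IsZero ∧ ∀ Y Z : MatFac d f, X.Iso (Y.directSum Z) → Y.IsZero ∨ Z.IsZero

/-- Over a local ring with maximal ideal `𝔫`, a matrix factorization is reduced if
`φ_k(X_k) ⊆ 𝔫 X_{k-1}` for all `k`. -/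
def IsReduced [IsLocalRing Q] {f : Q} (X : MatFac d f) : Prop :=
  ∀ k, (X.gr k).map X.map ≤ IsLocalRing.maximalIdeal Q • X.gr (k - 1)

/-- The rank one matrix factorization `(u_1, u_2, …, u_{d-1}, u_0)` of `u_1 u_2 ⋯ u_{d-1} u_0`:
every `X_k` is `Q`, and `φ_k : X_k → X_{k-1}` is multiplication by `u_k`. Elements of the total
module are written as functions `v` on `ZMod d`, with component `v k` in degree `k`. -/
def rankOne [NeZero d] (u : ZMod d → Q) : MatFac d (∏ k, u k) where
  carrier := ZMod d → Q
  gr k := LinearMap.range (LinearMap.single Q (fun _ : ZMod d => Q) k)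
  map := LinearMap.pi fun j => u (j + 1) • LinearMap.proj (j + 1)
  isInternal := by
    refine GradedAux.isInternal_of_proj _
      (fun k => LinearMap.single Q (fun _ : ZMod d => Q) k ∘ₗ LinearMap.proj k) ?_ ?_ ?_ ?_
    · intro k x
      exact ⟨x k, rfl⟩
    · rintro k _ ⟨c, rfl⟩
      simp
    · rintro k j hkj _ ⟨c, rfl⟩
      simp [Pi.single_eq_of_ne hkj]
    · intro x
      simpa using Finset.univ_sum_single x
  map_mem := by
    rintro k _ ⟨c, rfl⟩
    refine ⟨u k * c, ?_⟩
    funext j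
    by_cases h : j = k - 1
    · subst h
      simp
    · have h' : j + 1 ≠ k := fun h' => h (by rw [← h']; ring)
      simp [Pi.single_eq_of_ne h, Pi.single_eq_of_ne h']
  map_pow := by
    have h : ∀ (n : ℕ) (v : ZMod d → Q) (j : ZMod d),
        ((LinearMap.pi fun j : ZMod d => u (j + 1) • LinearMap.proj (R := Q)
          (φ := fun _ : ZMod d => Q) (j + 1)) ^ n) v j
          = (∏ i ∈ Finset.range n, u (j + 1 + i)) * v (j + n) := by
      intro n
      induction n with
      | zero => intro v j; simp
      | succ n ih =>
        intro v j
        rw [pow_succ, Module.End.mul_apply, ih, Finset.prod_range_succ]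
        simp only [LinearMap.pi_apply, LinearMap.smul_apply, LinearMap.proj_apply, smul_eq_mul,
          Nat.cast_add, Nat.cast_one]
        rw [show j + (n : ZMod d) + 1 = j + 1 + n by ring, mul_assoc,
          show j + ((n : ZMod d) + 1) = j + 1 + n by ring]
    refine LinearMap.ext fun v => funext fun j => ?_
    rw [h d v j]
    have hp : ∏ i ∈ Finset.range d, u (j + 1 + (i : ZMod d)) = ∏ k, u k := by
      rw [← Equiv.prod_comp (Equiv.addLeft (j + 1)) u]
      refine Finset.prod_nbij' (fun i : ℕ => (i : ZMod d)) (fun k : ZMod d => k.val) ?_ ?_ ?_ ?_ ?_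
      · intro i _
        exact Finset.mem_univ _
      · intro k _
        exact Finset.mem_range.mpr (ZMod.val_lt k)
      · intro i hi
        exact ZMod.val_cast_of_lt (Finset.mem_range.mp hi)
      · intro k _
        exact ZMod.natCast_zmod_val k
      · intro i _
        rfl
    rw [hp]
    simp

theorem rankOne_map_apply [NeZero d] (u : ZMod d → Q) (v : ZMod d → Q) (j : ZMod d) :
    ((rankOne u).map : (ZMod d → Q) →ₗ[Q] (ZMod d → Q)) v j = u (j + 1) * v (j + 1) := rfl

/-- Extension of scalars of a matrix factorization of `f` along a ring homomorphism `ρ`: a matrix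
factorization of `ρ f`. -/
noncomputable def baseChange [NeZero d] {Q' : Type u} [CommRing Q'] (ρ : Q →+* Q') {f : Q}
    (X : MatFac d f) : MatFac d (ρ f) :=
  letI : Algebra Q Q' := ρ.toAlgebra
  { carrier := Q' ⊗[Q] X.carrier
    gr := fun k => (X.gr k).baseChange Q'
    map := X.map.baseChange Q'
    isInternal := by
      refine GradedAux.isInternal_of_proj _
        (fun k => (GradedAux.proj X.isInternal k).baseChange Q') ?_ ?_ ?_ ?_
      · intro k x
        induction x using TensorProduct.induction_on with
        | zero => rw [map_zero]; exact zero_mem _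
        | tmul a m =>
          rw [LinearMap.baseChange_tmul]
          exact Submodule.tmul_mem_baseChange_of_mem a (GradedAux.proj_mem _ _ _)
        | add x y hx hy => rw [map_add]; exact add_mem hx hy
      · intro k x hx
        rw [Submodule.baseChange_eq_span] at hx
        refine Submodule.span_induction ?_ ?_ ?_ ?_ hx
        · rintro _ ⟨m, hm, rfl⟩
          simp [GradedAux.proj_same X.isInternal hm]
        · simp
        · intro x y _ _ hx hy
          rw [map_add, hx, hy]
        · intro a x _ hx
          rw [map_smul, hx]
      · intro k j hkj x hx
        rw [Submodule.baseChange_eq_span] at hx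
        refine Submodule.span_induction ?_ ?_ ?_ ?_ hx
        · rintro _ ⟨m, hm, rfl⟩
          simp [GradedAux.proj_ne X.isInternal hkj hm]
        · simp
        · intro x y _ _ hx hy
          rw [map_add, hx, hy, add_zero]
        · intro a x _ hx
          rw [map_smul, hx, smul_zero]
      · intro x
        induction x using TensorProduct.induction_on with
        | zero => simp
        | tmul a m =>
          simp only [LinearMap.baseChange_tmul]
          rw [← TensorProduct.tmul_sum, GradedAux.sum_proj]
        | add x y hx hy => simp only [map_add, Finset.sum_add_distrib, hx, hy]
    map_mem := by
      intro k x hx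
      rw [Submodule.baseChange_eq_span] at hx
      refine Submodule.span_induction ?_ ?_ ?_ ?_ hx
      · rintro _ ⟨m, hm, rfl⟩
        rw [TensorProduct.mk_apply, LinearMap.baseChange_tmul]
        exact Submodule.tmul_mem_baseChange_of_mem 1 (X.map_mem k m hm)
      · rw [map_zero]; exact zero_mem _
      · intro x y _ _ hx hy
        rw [map_add]; exact add_mem hx hy
      · intro a x _ hx
        rw [map_smul]; exact Submodule.smul_mem _ _ hx
    map_pow := by
      rw [← LinearMap.baseChange_pow, X.map_pow]
      refine LinearMap.ext fun x => ?_
      induction x using TensorProduct.induction_on with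
      | zero => simp
      | tmul a m =>
        simp only [LinearMap.baseChange_tmul, LinearMap.smul_apply, LinearMap.id_apply,
          TensorProduct.tmul_smul]
        rw [← algebraMap_smul Q' f (a ⊗ₜ[Q] m)]
        rfl
      | add x y hx hy => rw [map_add, hx, hy, map_add] }

/-- The structure map `Φ` of the tensor product: `Φ(x ⊗ y) = φ(x) ⊗ y + ζ^{|x|} x ⊗ ψ(y)` for
homogeneous `x`. -/
noncomputable def tensorMap (ζ : Q) {f g : Q} (X : MatFac d f) (Y : MatFac d g) :
    X.carrier ⊗[Q] Y.carrier →ₗ[Q] X.carrier ⊗[Q] Y.carrier :=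
  TensorProduct.map X.map LinearMap.id +
    TensorProduct.map (GradedAux.scale X.isInternal fun i : ZMod d => ζ ^ i.val) Y.map

theorem tensorMap_tmul (ζ : Q) {f g : Q} (X : MatFac d f) (Y : MatFac d g) (i : ZMod d)
    (x : X.carrier) (hx : x ∈ X.gr i) (y : Y.carrier) :
    tensorMap ζ X Y (x ⊗ₜ y) = X.map x ⊗ₜ y + ζ ^ i.val • (x ⊗ₜ Y.map y) := by
  simp [tensorMap, GradedAux.scale_apply X.isInternal _ hx, TensorProduct.smul_tmul']

/-- The degree `k` part `⨁_{i + j = k} X_i ⊗ Y_j` of the tensor product, as a submodule of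
`X ⊗ Y`. -/
def tensorGr {f g : Q} (X : MatFac d f) (Y : MatFac d g) (k : ZMod d) :
    Submodule Q (X.carrier ⊗[Q] Y.carrier) :=
  ⨆ (i : ZMod d) (j : ZMod d) (_ : i + j = k),
    Submodule.map₂ (TensorProduct.mk Q X.carrier Y.carrier) (X.gr i) (Y.gr j)

theorem tmul_mem_tensorGr {f g : Q} {X : MatFac d f} {Y : MatFac d g} {i j k : ZMod d}
    (h : i + j = k) {x : X.carrier} {y : Y.carrier} (hx : x ∈ X.gr i) (hy : y ∈ Y.gr j) :
    x ⊗ₜ[Q] y ∈ tensorGr X Y k := by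
  have h1 : x ⊗ₜ[Q] y ∈
      Submodule.map₂ (TensorProduct.mk Q X.carrier Y.carrier) (X.gr i) (Y.gr j) :=
    Submodule.apply_mem_map₂ _ hx hy
  exact Submodule.mem_iSup_of_mem i (Submodule.mem_iSup_of_mem j (Submodule.mem_iSup_of_mem h h1))

theorem tensorGr_le {f g : Q} {X : MatFac d f} {Y : MatFac d g} {k : ZMod d}
    {P : Submodule Q (X.carrier ⊗[Q] Y.carrier)}
    (h : ∀ i j, i + j = k → ∀ x ∈ X.gr i, ∀ y ∈ Y.gr j, x ⊗ₜ[Q] y ∈ P) :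
    tensorGr X Y k ≤ P :=
  iSup_le fun i => iSup_le fun j => iSup_le fun hij => Submodule.map₂_le.mpr fun x hx y hy =>
    h i j hij x hx y hy

theorem tensorGr_isInternal [NeZero d] {f g : Q} (X : MatFac d f) (Y : MatFac d g) :
    DirectSum.IsInternal (tensorGr X Y) := by
  have key : ∀ (i j k : ZMod d) (x : X.carrier) (y : Y.carrier), x ∈ X.gr i → y ∈ Y.gr j →
      (∑ s : ZMod d, TensorProduct.map (GradedAux.proj X.isInternal s)
        (GradedAux.proj Y.isInternal (k - s))) (x ⊗ₜ[Q] y)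
        = if i + j = k then x ⊗ₜ[Q] y else 0 := by
    intro i j k x y hx hy
    rw [LinearMap.sum_apply, Finset.sum_eq_single i]
    · rw [TensorProduct.map_tmul, GradedAux.proj_same _ hx]
      split_ifs with h
      · rw [← h, add_sub_cancel_left, GradedAux.proj_same _ hy]
      · rw [GradedAux.proj_ne _ _ hy, TensorProduct.tmul_zero]
        intro h'
        exact h (by rw [← h']; ring)
    · intro s _ hs
      rw [TensorProduct.map_tmul, GradedAux.proj_ne _ hs hx, TensorProduct.zero_tmul]
    · simp
  refine GradedAux.isInternal_of_proj _
    (fun k => ∑ s : ZMod d, TensorProduct.map (GradedAux.proj X.isInternal s)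
      (GradedAux.proj Y.isInternal (k - s))) ?_ ?_ ?_ ?_
  · intro k z
    induction z using TensorProduct.induction_on with
    | zero => rw [map_zero]; exact zero_mem _
    | tmul x y =>
      rw [LinearMap.sum_apply]
      refine Submodule.sum_mem _ fun s _ => ?_
      rw [TensorProduct.map_tmul]
      exact tmul_mem_tensorGr (by ring) (GradedAux.proj_mem _ s x) (GradedAux.proj_mem _ (k - s) y)
    | add x y hx hy => rw [map_add]; exact add_mem hx hy
  · intro k z hz
    have hle : tensorGr X Y k ≤ LinearMap.eqLocus
        (∑ s : ZMod d, TensorProduct.map (GradedAux.proj X.isInternal s)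
          (GradedAux.proj Y.isInternal (k - s))) LinearMap.id :=
      tensorGr_le fun i j hij x hx y hy => by
        rw [LinearMap.mem_eqLocus, key i j k x y hx hy, if_pos hij, LinearMap.id_apply]
    exact hle hz
  · intro k l hkl z hz
    have hle : tensorGr X Y l ≤ LinearMap.ker
        (∑ s : ZMod d, TensorProduct.map (GradedAux.proj X.isInternal s)
          (GradedAux.proj Y.isInternal (k - s))) :=
      tensorGr_le fun i j hij x hx y hy => by
        rw [LinearMap.mem_ker, key i j k x y hx hy, if_neg]
        intro h
        exact hkl (h.symm.trans hij)
    exact hle hz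
  · intro z
    induction z using TensorProduct.induction_on with
    | zero => simp
    | tmul x y =>
      rw [← GradedAux.sum_proj X.isInternal x, ← GradedAux.sum_proj Y.isInternal y,
        TensorProduct.sum_tmul]
      simp only [TensorProduct.tmul_sum, map_sum]
      rw [Finset.sum_comm]
      refine Finset.sum_congr rfl fun i _ => ?_
      rw [Finset.sum_comm]
      refine Finset.sum_congr rfl fun j _ => ?_
      simp only [fun k => key i j k _ _ (GradedAux.proj_mem X.isInternal i x)
        (GradedAux.proj_mem Y.isInternal j y)]
      simp
    | add x y hx hy => simp only [map_add, Finset.sum_add_distrib, hx, hy]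

theorem map_scale_comm [NeZero d] {ζ : Q} (hζ : ζ ^ d = 1) {f : Q} (X : MatFac d f) :
    X.map * GradedAux.scale X.isInternal (fun i : ZMod d => ζ ^ i.val)
      = ζ • (GradedAux.scale X.isInternal (fun i : ZMod d => ζ ^ i.val) * X.map) := by
  have hval : ∀ i : ZMod d, ζ ^ i.val = ζ * ζ ^ (i - 1).val := by
    intro i
    rw [← pow_succ']
    have h1 : (((i - 1).val + 1 : ℕ) : ZMod d) = i := by
      rw [Nat.cast_add, ZMod.natCast_zmod_val]
      simp
    have h2 : i.val = ((i - 1).val + 1) % d := by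
      conv_lhs => rw [← h1]
      exact ZMod.val_natCast _ _
    rw [h2]
    exact (pow_eq_pow_mod _ hζ).symm
  refine GradedAux.ext_of_homogeneous X.isInternal fun i x hx => ?_
  rw [Module.End.mul_apply, LinearMap.smul_apply, Module.End.mul_apply,
    GradedAux.scale_apply _ _ hx, GradedAux.scale_apply _ _ (X.map_mem i x hx), map_smul,
    smul_smul, ← hval]

/-- The tensor product `X ⊗_ζ Y` of matrix factorizations of `f` and of `g`, a matrix
factorization of `f + g`, over a ring without zero divisors in which `ζ` is a primitive `d`-th
root of unity. -/
noncomputable def tensor [NeZero d] [NoZeroDivisors Q] (ζ : Q) (hζ : IsPrimitiveRoot ζ d)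
    {f g : Q} (X : MatFac d f) (Y : MatFac d g) : MatFac d (f + g) where
  carrier := X.carrier ⊗[Q] Y.carrier
  gr := tensorGr X Y
  map := tensorMap ζ X Y
  isInternal := tensorGr_isInternal X Y
  map_mem k z hz := by
    have hle : tensorGr X Y k ≤ (tensorGr X Y (k - 1)).comap (tensorMap ζ X Y) :=
      tensorGr_le fun i j hij x hx y hy => by
        rw [Submodule.mem_comap, tensorMap_tmul ζ X Y i x hx y]
        refine add_mem (tmul_mem_tensorGr ?_ (X.map_mem i x hx) hy)
          (Submodule.smul_mem _ _ (tmul_mem_tensorGr ?_ hx (Y.map_mem j y hy)))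
        · rw [← hij]; ring
        · rw [← hij]; ring
    exact hle hz
  map_pow := by
    have hcomm := map_scale_comm hζ.pow_eq_one X
    have hpow : GradedAux.scale X.isInternal (fun i : ZMod d => ζ ^ i.val) ^ d
        = LinearMap.id := by
      rw [GradedAux.scale_pow, ← GradedAux.scale_eq_of_const X.isInternal]
      congr 1
      funext i
      rw [← pow_mul, mul_comm, pow_mul, hζ.pow_eq_one, one_pow]
    rw [tensorMap, GradedAux.add_pow_primitiveRoot hζ, TensorProduct.map_pow,
      TensorProduct.map_pow, X.map_pow, Y.map_pow, hpow]
    · refine TensorProduct.ext' fun x y => ?_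
      simp only [LinearMap.add_apply, TensorProduct.map_tmul, LinearMap.smul_apply,
        add_smul, ← Module.End.one_eq_id, one_pow, Module.End.one_apply,
        TensorProduct.tmul_smul, TensorProduct.smul_tmul']
    · rw [← TensorProduct.map_mul, ← TensorProduct.map_mul, hcomm, TensorProduct.map_smul_left]
      rfl

end MatFac

/-! ### Power series in disjoint sets of variables -/

/-- The inclusion `k⟦x₁,…,x_a⟧ ⊆ k⟦x₁,…,x_a,y₁,…,y_b⟧`. -/
noncomputable def inclX (k : Type u) [Field k] (a b : ℕ) :
    MvPowerSeries (Fin a) k →+* MvPowerSeries (Fin a ⊕ Fin b) k :=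
  (MvPowerSeries.rename (R := k) (Sum.inl : Fin a → Fin a ⊕ Fin b)).toRingHom

/-- The inclusion `k⟦y₁,…,y_b⟧ ⊆ k⟦x₁,…,x_a,y₁,…,y_b⟧`. -/
noncomputable def inclY (k : Type u) [Field k] (a b : ℕ) :
    MvPowerSeries (Fin b) k →+* MvPowerSeries (Fin a ⊕ Fin b) k :=
  (MvPowerSeries.rename (R := k) (Sum.inr : Fin b → Fin a ⊕ Fin b)).toRingHom

theorem isPrimitiveRoot_C {k : Type u} [Field k] {σ : Type*} {ζ : k} {d : ℕ}
    (hζ : IsPrimitiveRoot ζ d) :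
    IsPrimitiveRoot (MvPowerSeries.C ζ : MvPowerSeries σ k) d :=
  hζ.map_of_injective (f := (MvPowerSeries.C : k →+* MvPowerSeries σ k))
    (MvPowerSeries.C_injective)

/-- For factorizations `X` over `k⟦x⟧` and `Y` over `k⟦y⟧`, the tensor product `X ⊗_ζ Y` over
`k⟦x, y⟧`, formed after extending scalars along the two inclusions. -/
noncomputable def disjointTensor {k : Type u} [Field k] {d : ℕ} [NeZero d] (ζ : k)
    (hζ : IsPrimitiveRoot ζ d) {a b : ℕ} {f : MvPowerSeries (Fin a) k}
    {g : MvPowerSeries (Fin b) k} (X : MatFac d f) (Y : MatFac d g) :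
    MatFac d (inclX k a b f + inclY k a b g) :=
  MatFac.tensor (MvPowerSeries.C ζ) (isPrimitiveRoot_C hζ)
    (X.baseChange (inclX k a b)) (Y.baseChange (inclY k a b))

/-! ### Idempotents in rings -/

/-! In a homogeneous basis of X, let `A` be the matrix of φ and `D` the diagonal matrix of the
powers ζ^deg. Since Y has rank one, a degree-0 endomorphism of X ⊗ Y is a d × d block matrix `M`
whose block (p, q) has the shape of a map between two shifts of X. Commuting with the structure map
means M_{p,q} A + u_q M_{p,q-1} D = A M_{p,q} + u_{p+1} D M_{p+1,q}. Indecomposability amounts to `M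
= 0` or `M = 1` for every idempotent `M` of this kind, and two specializations decide it.

Setting x = 0 kills `A`, because X is reduced. For p = q - 1 the nonzero factor u_q cancels, and so
does `D`, since diagonal blocks preserve degree. Hence consecutive diagonal blocks agree modulo x,
and all diagonal blocks have the same constant term.

Setting y = 0 kills every u_q, because Y is reduced. The blocks then commute with `A`, so `M`
becomes an idempotent endomorphism of the sum of all shifts of X. As X is indecomposable, its
degree-0 endomorphisms are units or have nilpotent constant term
(`isUnit_or_isNilpotent_of_commute`), so sums of nonunits are nonunits. As X is not isomorphic to a
proper shift of itself, composites through a different shift are never units. If the diagonal blocks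
are nonunits, `M` has zero constant term (`map_eq_zero_of_isNilpotent_diag`); if they are units, the
same holds for 1 - M. This dichotomy is `map_blocks_eq_zero_or_one`.

An idempotent matrix of power series with zero constant term vanishes, so the conclusion lifts back
to `M` in `blocks_eq_zero_or_one`. -/

theorem isNilpotent_mul_swap {R : Type*} [Ring R] {x y : R} (h : IsNilpotent (x * y)) :
    IsNilpotent (y * x) := by
  obtain ⟨n, hn⟩ := h
  have key : ∀ m : ℕ, (y * x) ^ (m + 1) = y * (x * y) ^ m * x := by
    intro m
    induction m with
    | zero => simp
    | succ m ih =>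
      rw [pow_succ, ih, pow_succ]
      simp only [mul_assoc]
  exact ⟨n + 1, by rw [key, hn, mul_zero, zero_mul]⟩

/-- An idempotent `b` vanishes if all corners of elements of the left ideal `R b` along a
finite family with sum `1` are nilpotent. -/
theorem IsIdempotentElem.eq_zero_of_isNilpotent_corners {R ι : Type*} [Ring R] [Fintype ι]
    {b : R} (hb : IsIdempotentElem b) (P : ι → R) (hP : ∀ i, IsIdempotentElem (P i))
    (hsum : ∑ i, P i = 1) (h : ∀ y i, IsNilpotent (P i * (y * b) * P i)) : b = 0 := by
  -- Since b = ∑ b P_i, it is enough to treat each b P_i. Swapping the factors P_i and y b P_i turns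
  -- nilpotence of the corner into nilpotence of y b P_i, which makes 1 + y b P_i invertible.
  have hmem : b ∈ (⊥ : Ideal R).jacobson := by
    rw [← mul_one b, ← hsum, Finset.mul_sum]
    refine Ideal.sum_mem _ fun i _ => Ideal.mem_jacobson_iff.mpr fun y => ?_
    have hnil : IsNilpotent (y * (b * P i)) := by
      have h1 : IsNilpotent (P i * ((y * b) * P i)) := by
        rw [← mul_assoc]; exact h y i
      have h2 := isNilpotent_mul_swap h1
      rwa [mul_assoc (y * b), (hP i).eq, mul_assoc] at h2
    obtain ⟨w, hw⟩ := hnil.isUnit_one_add.exists_left_inv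
    refine ⟨w, ?_⟩
    rw [Submodule.mem_bot, sub_eq_zero, ← hw, mul_add, mul_one, mul_assoc, add_comm]
  -- The multiplier -1 gives a left inverse of 1 - b, while (1 - b) b = 0.
  obtain ⟨z, hz⟩ := Ideal.mem_jacobson_iff.mp hmem (-1)
  rw [Submodule.mem_bot, sub_eq_zero] at hz
  have h1 : z * (1 - b) = 1 := by
    rw [mul_neg, mul_one, neg_mul, add_comm, ← sub_eq_add_neg] at hz
    rw [mul_sub, mul_one, hz]
  calc b = z * (1 - b) * b := by rw [h1, one_mul]
    _ = z * (b - b * b) := by noncomm_ring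
    _ = 0 := by rw [hb.eq, sub_self, mul_zero]

/-- Some polynomial in an integral element `a` of an algebra over a field is an idempotent
which is `0` only if `a` is nilpotent and `1` only if `a` is a unit. -/
theorem exists_polynomial_idempotent {k A : Type*} [Field k] [Ring A] [Algebra k A] {a : A}
    (ha : IsIntegral k a) : ∃ p : Polynomial k, IsIdempotentElem (Polynomial.aeval a p) ∧
      (Polynomial.aeval a p = 0 → IsNilpotent a) ∧ (Polynomial.aeval a p = 1 → IsUnit a) := by
  -- The extra factor X makes the multiplicity of the root 0 positive; the factorization of the
  -- inverse of `a` at the end needs this.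
  have h0 : Polynomial.X * minpoly k a ≠ 0 := mul_ne_zero Polynomial.X_ne_zero (minpoly.ne_zero ha)
  obtain ⟨q, hq, hndvd⟩ := Polynomial.exists_eq_pow_rootMultiplicity_mul_and_not_dvd _ h0 0
  generalize (Polynomial.X * minpoly k a).rootMultiplicity 0 = n at hq
  rw [Polynomial.C_0, sub_zero] at hq hndvd
  obtain ⟨m, rfl⟩ : ∃ m, n = m + 1 := by
    cases n with
    | zero =>
      rw [pow_zero, one_mul] at hq
      exact absurd (hq ▸ Dvd.intro _ rfl) hndvd
    | succ m => exact ⟨m, rfl⟩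
  have hcop : IsCoprime ((Polynomial.X : Polynomial k) ^ (m + 1)) q :=
    ((Polynomial.irreducible_X.coprime_iff_not_dvd).mpr hndvd).pow_left
  obtain ⟨v, w, hvw⟩ := hcop
  have hz : Polynomial.aeval a (Polynomial.X ^ (m + 1) * q) = 0 := by
    rw [← hq, map_mul, minpoly.aeval, mul_zero]
  -- By the Bézout relation this polynomial is 0 modulo X^(m+1) and 1 modulo q: it is the Fitting
  -- projector onto the part where `a` is invertible.
  refine ⟨v * Polynomial.X ^ (m + 1), ?_, ?_, ?_⟩
  · have h1 : v * Polynomial.X ^ (m + 1) * (v * Polynomial.X ^ (m + 1))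
        = v * Polynomial.X ^ (m + 1) - v * w * (Polynomial.X ^ (m + 1) * q) := by
      linear_combination (v * Polynomial.X ^ (m + 1)) * hvw
    rw [IsIdempotentElem, ← map_mul, h1, map_sub, map_mul _ (v * w), hz, mul_zero, sub_zero]
  · intro h
    refine ⟨m + 1, ?_⟩
    have h1 : (Polynomial.X : Polynomial k) ^ (m + 1)
        = Polynomial.X ^ (m + 1) * (v * Polynomial.X ^ (m + 1))
          + w * (Polynomial.X ^ (m + 1) * q) := by
      linear_combination -(Polynomial.X ^ (m + 1)) * hvw
    have h2 := congrArg (Polynomial.aeval a) h1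
    rw [map_add, map_mul, map_mul _ w, hz, h, mul_zero, mul_zero, add_zero] at h2
    simpa using h2
  · intro h
    have hl : Polynomial.aeval a (v * Polynomial.X ^ m) * a = 1 := by
      rw [← h]; simp [pow_succ, mul_assoc]
    have hr : a * Polynomial.aeval a (v * Polynomial.X ^ m) = 1 := by
      have hc : Commute (Polynomial.aeval a (v * Polynomial.X ^ m)) (Polynomial.aeval a Polynomial.X) :=
        Commute.map (Commute.all _ _) _
      rw [Polynomial.aeval_X] at hc
      rw [← hc.eq, hl]
    exact ⟨⟨a, _, hr, hl⟩, rfl⟩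

/-- Local criterion: if `x` or `1 - x` is a unit for all `x` in the commutant of `𝒜`, then
nonunits of the commutant are closed under addition. -/
theorem not_isUnit_add_of_local {E : Type*} [Ring E] (𝒜 : Set E)
    (H : ∀ x : E, (∀ a ∈ 𝒜, Commute x a) → IsUnit x ∨ IsUnit (1 - x)) {g h : E}
    (hg : ∀ a ∈ 𝒜, Commute g a) (hh : ∀ a ∈ 𝒜, Commute h a) (hgu : ¬ IsUnit g)
    (hhu : ¬ IsUnit h) : ¬ IsUnit (g + h) := by
  rintro ⟨v, hv⟩
  -- The commutant is closed under inverses, so being a unit in it and being a unit in `E` are the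
  -- same condition.
  have hvc : ∀ a ∈ 𝒜, Commute (↑v⁻¹ : E) a := fun a ha => by
    have : Commute (v : E) a := by
      rw [hv]; exact (hg a ha).add_left (hh a ha)
    exact this.units_inv_left
  have h1 : (↑v⁻¹ : E) * g + (↑v⁻¹ : E) * h = 1 := by
    rw [← mul_add, ← hv, Units.inv_mul]
  rcases H (↑v⁻¹ * g) (fun a ha => (hvc a ha).mul_left (hg a ha)) with h2 | h2
  · refine hgu ?_
    rw [← Units.mul_inv_cancel_left v g]
    exact v.isUnit.mul h2
  · refine hhu ?_
    rw [← Units.mul_inv_cancel_left v h, eq_sub_of_add_eq' h1]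
    exact v.isUnit.mul h2

theorem not_isUnit_sum_of_local {E : Type*} [Ring E] [Nontrivial E] (𝒜 : Set E)
    (H : ∀ x : E, (∀ a ∈ 𝒜, Commute x a) → IsUnit x ∨ IsUnit (1 - x))
    {ι : Type*} (s : Finset ι) (g : ι → E) (hg : ∀ i ∈ s, ∀ a ∈ 𝒜, Commute (g i) a)
    (hgu : ∀ i ∈ s, ¬ IsUnit (g i)) : ¬ IsUnit (∑ i ∈ s, g i) := by
  classical
  induction s using Finset.induction_on with
  | empty => simp
  | insert i s hi ih =>
    rw [Finset.sum_insert hi]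
    exact not_isUnit_add_of_local 𝒜 H (hg i (Finset.mem_insert_self i s))
      (fun a ha => Commute.sum_left _ _ _ fun j hj => hg j (Finset.mem_insert_of_mem hj) a ha)
      (hgu i (Finset.mem_insert_self i s))
      (ih (fun j hj => hg j (Finset.mem_insert_of_mem hj))
        fun j hj => hgu j (Finset.mem_insert_of_mem hj))

/-! ### Matrices of power series -/

namespace MvPowerSeries

section Filtration

variable (σ R : Type*) [CommRing R]

/-- The ideal of the power series without monomials of degree less than `n`. -/
def orderIdeal (n : ℕ) : Ideal (MvPowerSeries σ R) where
  carrier := {s | ∀ m : σ →₀ ℕ, m.degree < n → coeff m s = 0}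
  zero_mem' m _ := by simp
  add_mem' hs ht m hm := by rw [map_add, hs m hm, ht m hm, add_zero]
  smul_mem' c s hs m hm := by
    classical
    rw [smul_eq_mul, coeff_mul]
    refine Finset.sum_eq_zero fun x hx => ?_
    rw [Finset.HasAntidiagonal.mem_antidiagonal] at hx
    rw [hs x.2 (by rw [← hx, map_add] at hm; omega), mul_zero]

variable {σ R}

theorem mul_mem_orderIdeal {a b : ℕ} {s t : MvPowerSeries σ R} (hs : s ∈ orderIdeal σ R a)
    (ht : t ∈ orderIdeal σ R b) : s * t ∈ orderIdeal σ R (a + b) := by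
  classical
  intro m hm
  rw [coeff_mul]
  refine Finset.sum_eq_zero fun x hx => ?_
  rw [Finset.HasAntidiagonal.mem_antidiagonal] at hx
  rw [← hx, map_add] at hm
  rcases lt_or_ge x.1.degree a with h | h
  · rw [hs _ h, zero_mul]
  · rw [ht x.2 (by omega), mul_zero]

theorem orderIdeal_anti {a b : ℕ} (h : a ≤ b) : orderIdeal σ R b ≤ orderIdeal σ R a :=
  fun _ hs m hm => hs m (hm.trans_le h)

theorem mem_orderIdeal_one {s : MvPowerSeries σ R} :
    s ∈ orderIdeal σ R 1 ↔ constantCoeff s = 0 := by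
  refine ⟨fun h => ?_, fun h m hm => ?_⟩
  · rw [← coeff_zero_eq_constantCoeff_apply]
    exact h 0 (by simp)
  · obtain rfl : m = 0 := by
      rw [← Finsupp.degree_eq_zero_iff]; omega
    simpa using h

theorem eq_zero_of_forall_mem_orderIdeal {s : MvPowerSeries σ R}
    (h : ∀ n, s ∈ orderIdeal σ R n) : s = 0 :=
  ext fun m => by simpa using h (m.degree + 1) m (Nat.lt_succ_self _)

/-- Completeness of power series rings for the filtration by order. -/
theorem exists_forall_sub_mem_orderIdeal (s : ℕ → MvPowerSeries σ R)
    (hs : ∀ n, s (n + 1) - s n ∈ orderIdeal σ R (n + 1)) :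
    ∃ t, ∀ n, t - s n ∈ orderIdeal σ R (n + 1) := by
  -- The coefficient at m no longer changes from index `m.degree` on.
  obtain ⟨t, ht⟩ : ∃ t : MvPowerSeries σ R, ∀ m, coeff m t = coeff m (s m.degree) :=
    ⟨fun m => coeff m (s m.degree), fun m => rfl⟩
  refine ⟨t, fun n m hm => ?_⟩
  have h : ∀ r, coeff m (s (m.degree + r)) = coeff m (s m.degree) := by
    intro r
    induction r with
    | zero => rfl
    | succ r ih =>
      rw [← ih, ← sub_eq_zero, ← map_sub]
      exact hs (m.degree + r) m (by omega)
  rw [map_sub, sub_eq_zero, ht]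
  exact (h (n - m.degree)).symm.trans (by rw [Nat.add_sub_cancel' (by omega)])

end Filtration

section Matrix

variable {σ k n : Type*} [Field k] [Fintype n] [DecidableEq n]

/-- The constant term of a matrix of power series. -/
noncomputable abbrev matrixConstantCoeff :
    Matrix n n (MvPowerSeries σ k) →+* Matrix n n k :=
  (constantCoeff (σ := σ) (R := k)).mapMatrix

theorem isUnit_matrix_iff {M : Matrix n n (MvPowerSeries σ k)} :
    IsUnit M ↔ IsUnit (matrixConstantCoeff M) := by
  rw [Matrix.isUnit_iff_isUnit_det, Matrix.isUnit_iff_isUnit_det, isUnit_iff_constantCoeff,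
    RingHom.map_det]

/-- The matrix 1 - M has constant term 1, hence is invertible, and it annihilates M. -/
theorem eq_zero_of_isIdempotentElem {M : Matrix n n (MvPowerSeries σ k)}
    (hM : IsIdempotentElem M) (h : matrixConstantCoeff M = 0) : M = 0 := by
  have hu : IsUnit (1 - M) := isUnit_matrix_iff.mpr (by rw [map_sub, h, map_one, sub_zero]; exact isUnit_one)
  refine hu.mul_left_eq_zero.mp ?_
  rw [mul_sub, mul_one, hM.eq, sub_self]

/-- Idempotents lift from constant matrices to matrices of power series, inside the commutant
of a given set. -/
theorem exists_isIdempotentElem_lift (𝒜 : Set (Matrix n n (MvPowerSeries σ k)))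
    (e : Matrix n n (MvPowerSeries σ k)) (he : IsIdempotentElem (matrixConstantCoeff e))
    (hc : ∀ a ∈ 𝒜, Commute e a) :
    ∃ e' : Matrix n n (MvPowerSeries σ k), IsIdempotentElem e' ∧ (∀ a ∈ 𝒜, Commute e' a) ∧
      matrixConstantCoeff e' = matrixConstantCoeff e := by
  let I : ℕ → Ideal (MvPowerSeries σ k) := orderIdeal σ k
  have hmul : ∀ {a b : ℕ} {T U : Matrix n n (MvPowerSeries σ k)}, (∀ i j, T i j ∈ I a) →
      (∀ i j, U i j ∈ I b) → ∀ i j, (T * U) i j ∈ I (a + b) := fun hT hU i j =>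
    Ideal.sum_mem _ fun l _ => mul_mem_orderIdeal (hT i l) (hU l j)
  have htriv : ∀ (T : Matrix n n (MvPowerSeries σ k)) (i j), T i j ∈ I 0 := fun T i j m hm => by
    simp at hm
  -- The iteration x ↦ 3x² - 2x³ replaces the defect x² - x by a multiple of its square. Its values
  -- are polynomials in `e`, so they stay in the commutant of `𝒜`.
  let E : ℕ → Matrix n n (MvPowerSeries σ k) := fun r =>
    (fun x => 3 * (x * x) - 2 * (x * x * x))^[r] e
  have hE0 : E 0 = e := rfl
  have hE : ∀ r, E (r + 1) = 3 * (E r * E r) - 2 * (E r * E r * E r) := fun r =>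
    Function.iterate_succ_apply' _ r e
  have hEc : ∀ a ∈ 𝒜, ∀ r, Commute (E r) a := by
    intro a ha r
    induction r with
    | zero => exact hc a ha
    | succ r ih =>
      rw [hE]
      exact ((Commute.ofNat_left 3 a).mul_left (ih.mul_left ih)).sub_left
        ((Commute.ofNat_left 2 a).mul_left ((ih.mul_left ih).mul_left ih))
  have hEi : ∀ r, ∀ i j, (E r * E r - E r) i j ∈ I (r + 1) := by
    intro r
    induction r with
    | zero =>
      intro i j
      rw [hE0, mem_orderIdeal_one]
      have h1 : matrixConstantCoeff (e * e - e) = 0 := by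
        rw [map_sub, map_mul, he.eq, sub_self]
      exact congrFun (congrFun h1 i) j
    | succ r ih =>
      intro i j
      have h1 : E (r + 1) * E (r + 1) - E (r + 1)
          = (E r * E r - E r) * (E r * E r - E r) * (4 * (E r * E r) - 4 * E r - 3) := by
        rw [hE]; noncomm_ring
      rw [h1]
      -- The order of the defect at least doubles; growth by one per step, r + 2 ≤ 2(r + 1), is
      -- enough.
      exact orderIdeal_anti (by omega) (hmul (hmul ih ih) (htriv _) i j)
  have hEd : ∀ r, ∀ i j, (E (r + 1) - E r) i j ∈ I (r + 1) := by
    intro r i j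
    have h1 : E (r + 1) - E r = (E r * E r - E r) * (1 - 2 * E r) := by
      rw [hE]; noncomm_ring
    rw [h1]
    exact hmul (hEi r) (htriv _) i j
  choose t ht using fun i j => exists_forall_sub_mem_orderIdeal (fun r => E r i j) (hEd · i j)
  let e' : Matrix n n (MvPowerSeries σ k) := Matrix.of t
  have he' : ∀ r, (Ideal.Quotient.mk (I (r + 1))).mapMatrix e'
      = (Ideal.Quotient.mk (I (r + 1))).mapMatrix (E r) := by
    intro r
    ext i j
    exact Ideal.Quotient.eq.mpr (ht i j r)
  have hsep : ∀ T U : Matrix n n (MvPowerSeries σ k), (∀ r,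
      (Ideal.Quotient.mk (I (r + 1))).mapMatrix T = (Ideal.Quotient.mk (I (r + 1))).mapMatrix U) →
      T = U := by
    intro T U h
    ext1 i j
    refine sub_eq_zero.mp (eq_zero_of_forall_mem_orderIdeal fun r => ?_)
    exact orderIdeal_anti (Nat.le_succ r)
      (Ideal.Quotient.eq.mp (congrFun (congrFun (h r) i) j))
  refine ⟨e', hsep _ _ fun r => ?_, fun a ha => hsep _ _ fun r => ?_, ?_⟩
  · rw [map_mul, he', ← map_mul]
    ext i j
    exact Ideal.Quotient.eq.mpr (hEi r i j)
  · rw [map_mul, map_mul, he', ← map_mul, ← map_mul, (hEc a ha r).eq]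
  · ext i j
    have h1 := mem_orderIdeal_one.mp (ht i j 0)
    rw [map_sub, sub_eq_zero] at h1
    exact h1

/-- If a set of matrices of power series commutes with no nontrivial idempotent, then every
matrix in its commutant is invertible or has a nilpotent constant term. -/
theorem isUnit_or_isNilpotent_of_commute (𝒜 : Set (Matrix n n (MvPowerSeries σ k)))
    (H : ∀ e : Matrix n n (MvPowerSeries σ k), IsIdempotentElem e → (∀ a ∈ 𝒜, Commute e a) →
      e = 0 ∨ e = 1)
    (h : Matrix n n (MvPowerSeries σ k)) (hc : ∀ a ∈ 𝒜, Commute h a) :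
    IsUnit h ∨ IsNilpotent (matrixConstantCoeff h) := by
  obtain ⟨p, hp, h0, h1⟩ := exists_polynomial_idempotent
    (Algebra.IsIntegral.isIntegral (R := k) (matrixConstantCoeff h))
  have hmap : matrixConstantCoeff (Polynomial.aeval h p)
      = Polynomial.aeval (matrixConstantCoeff h) p := by
    rw [Polynomial.aeval_def, Polynomial.hom_eval₂, Polynomial.aeval_def]
    congr 1
    ext c i j
    by_cases hij : i = j <;> simp [Matrix.algebraMap_matrix_apply, hij, algebraMap_apply]
  have hcomm : ∀ a ∈ 𝒜, Commute (Polynomial.aeval h p) a := by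
    intro a ha
    clear * - hc ha
    induction p using Polynomial.induction_on' with
    | add p q hp hq => rw [map_add]; exact hp.add_left hq
    | monomial r c =>
      rw [Polynomial.aeval_monomial]
      exact Commute.mul_left (Algebra.commutes c a) ((hc a ha).pow_left r)
  -- The matrix p(h) is idempotent only modulo the maximal ideal. Its lift is a genuine idempotent
  -- of the commutant, hence 0 or 1, and this decides the constant term of p(h).
  obtain ⟨e', he', hc', hce⟩ := exists_isIdempotentElem_lift 𝒜 (Polynomial.aeval h p)
    (by rwa [hmap]) hcomm
  rw [hmap] at hce
  rcases H e' he' hc' with rfl | rfl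
  · right
    exact h0 (by rw [← hce, map_zero])
  · left
    exact isUnit_matrix_iff.mpr (h1 (by rw [← hce, map_one]))

/-- A nonunit of the commutant has nilpotent constant term, so its difference from 1 is a unit; this
is the hypothesis of the local criterion. -/
theorem not_isUnit_sum_of_commute (𝒜 : Set (Matrix n n (MvPowerSeries σ k))) [Nonempty n]
    (H : ∀ e : Matrix n n (MvPowerSeries σ k), IsIdempotentElem e → (∀ a ∈ 𝒜, Commute e a) →
      e = 0 ∨ e = 1)
    {ι : Type*} (s : Finset ι) (g : ι → Matrix n n (MvPowerSeries σ k))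
    (hg : ∀ i ∈ s, ∀ a ∈ 𝒜, Commute (g i) a) (hgu : ∀ i ∈ s, ¬ IsUnit (g i)) :
    ¬ IsUnit (∑ i ∈ s, g i) := by
  refine not_isUnit_sum_of_local 𝒜 (fun x hx => ?_) s g hg hgu
  refine (isUnit_or_isNilpotent_of_commute 𝒜 H x hx).imp_right fun h => ?_
  rw [isUnit_matrix_iff, map_sub, map_one]
  exact h.isUnit_one_sub

end Matrix

end MvPowerSeries

/-! ### Idempotent block matrices -/

section Blocks

variable {P E F : Type*} [Fintype P] [DecidableEq P] [Ring E] [Ring F]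

/-- The subring of the matrices whose entries lie in prescribed additive subgroups. -/
def blockSubring (G : P → P → AddSubgroup E) (h1 : ∀ p, 1 ∈ G p p)
    (hmul : ∀ p q r, ∀ x ∈ G p q, ∀ y ∈ G q r, x * y ∈ G p r) : Subring (Matrix P P E) where
  carrier := {y | ∀ p q, y p q ∈ G p q}
  mul_mem' hx hy p r := sum_mem fun q _ => hmul p q r _ (hx p q) _ (hy q r)
  one_mem' p q := by
    by_cases h : p = q
    · subst h; rw [Matrix.one_apply_eq]; exact h1 p
    · rw [Matrix.one_apply_ne h]; exact zero_mem _
  add_mem' hx hy p q := add_mem (hx p q) (hy p q)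
  zero_mem' p q := zero_mem _
  neg_mem' hx p q := neg_mem (hx p q)

/-- Nilpotence is known only after applying `c`, so the corner criterion is used in the image under
`c` of the ring of block matrices, with the diagonal matrix units as the family. Working in that
subring rather than in all matrices means that only multipliers `y` with entries in `G` have to be
tested. -/
theorem map_eq_zero_of_isNilpotent_diag (c : E →+* F) (G : P → P → AddSubgroup E)
    (h1 : ∀ p, 1 ∈ G p p) (hmul : ∀ p q r, ∀ x ∈ G p q, ∀ y ∈ G q r, x * y ∈ G p r)
    (M : Matrix P P E) (hM : IsIdempotentElem M) (hMG : ∀ p q, M p q ∈ G p q)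
    (hnil : ∀ y : Matrix P P E, (∀ p q, y p q ∈ G p q) → ∀ p, IsNilpotent (c ((y * M) p p))) :
    c.mapMatrix M = 0 := by
  let B : Subring (Matrix P P F) := (blockSubring G h1 hmul).map c.mapMatrix
  let D : P → Matrix P P E := fun p => Matrix.diagonal (Pi.single p 1)
  have hDB : ∀ p, D p ∈ blockSubring G h1 hmul := by
    intro p q r
    by_cases hqr : q = r
    · subst hqr
      by_cases hpq : q = p
      · subst hpq; simpa [D] using h1 q
      · simp [D, hpq, zero_mem]
    · simp [D, hqr, zero_mem]
  let β : B := ⟨c.mapMatrix M, M, hMG, rfl⟩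
  let Q : P → B := fun p => ⟨c.mapMatrix (D p), D p, hDB p, rfl⟩
  have hDD : ∀ p, D p * D p = D p := by
    intro p
    simp only [D, Matrix.diagonal_mul_diagonal]
    congr 1
    funext i
    by_cases h : i = p
    · subst h; simp
    · simp [h]
  have hβ : β = 0 := by
    refine IsIdempotentElem.eq_zero_of_isNilpotent_corners (P := Q) ?_ ?_ ?_ ?_
    · exact Subtype.ext (by
        change c.mapMatrix M * c.mapMatrix M = c.mapMatrix M
        rw [← map_mul, hM.eq])
    · intro p
      exact Subtype.ext (by
        change c.mapMatrix (D p) * c.mapMatrix (D p) = c.mapMatrix (D p)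
        rw [← map_mul, hDD])
    · refine Subtype.ext ?_
      rw [AddSubmonoidClass.coe_finsetSum]
      change ∑ p, c.mapMatrix (D p) = 1
      rw [← map_sum, ← map_one c.mapMatrix]
      congr 1
      ext i j
      by_cases hij : i = j
      · subst hij; simp [Matrix.sum_apply, D, Finset.sum_pi_single]
      · simp [Matrix.sum_apply, D, hij]
    · rintro ⟨_, y, hy, rfl⟩ p
      obtain ⟨n, hn⟩ := hnil y hy p
      -- The exponent is kept positive so that the zero diagonal entries outside `p` have zero
      -- power.
      refine ⟨n + 1, Subtype.ext ?_⟩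
      rw [SubmonoidClass.coe_pow]
      change (c.mapMatrix (D p) * (c.mapMatrix y * c.mapMatrix M) * c.mapMatrix (D p)) ^ (n + 1) = 0
      have h2 : c.mapMatrix (D p) * (c.mapMatrix y * c.mapMatrix M) * c.mapMatrix (D p)
          = Matrix.diagonal (Pi.single p (c ((y * M) p p))) := by
        rw [← map_mul, ← map_mul, ← map_mul]
        ext i j
        by_cases hi : i = p
        · subst hi
          by_cases hj : j = i
          · subst hj; simp [D]
          · simp [D, hj, Ne.symm hj]
        · by_cases hij : i = j
          · subst hij; simp [D, hi]
          · simp [D, hi, hij]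
      rw [h2, Matrix.diagonal_pow]
      ext i j
      by_cases hij : i = j
      · subst hij
        by_cases hi : i = p
        · subst hi; simp [pow_succ, hn]
        · simp [hi]
      · simp [hij]
  exact congrArg Subtype.val hβ

end Blocks

/-! ### Homogeneous matrices commuting with a structure map -/

section Homogeneous

variable {ι R : Type*} [Fintype ι] [DecidableEq ι] [CommRing R] {d : ℕ}

/-- The matrices commuting with `A` which describe maps from degree `· + q` to degree `· + p`. -/
def homogeneousCommutant (deg : ι → ZMod d) (A : Matrix ι ι R) (p q : ZMod d) :
    AddSubgroup (Matrix ι ι R) where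
  carrier := {h | (∀ i j, deg i + p ≠ deg j + q → h i j = 0) ∧ Commute h A}
  add_mem' hx hy := ⟨fun i j hij => by rw [Matrix.add_apply, hx.1 i j hij, hy.1 i j hij, add_zero],
    hx.2.add_left hy.2⟩
  zero_mem' := ⟨fun _ _ _ => rfl, Commute.zero_left A⟩
  neg_mem' hx := ⟨fun i j hij => by rw [Matrix.neg_apply, hx.1 i j hij, neg_zero], hx.2.neg_left⟩

theorem mem_homogeneousCommutant {deg : ι → ZMod d} {A : Matrix ι ι R} {p q : ZMod d}
    {h : Matrix ι ι R} : h ∈ homogeneousCommutant deg A p q ↔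
      (∀ i j, deg i + p ≠ deg j + q → h i j = 0) ∧ Commute h A := Iff.rfl

theorem one_mem_homogeneousCommutant (deg : ι → ZMod d) (A : Matrix ι ι R) (p : ZMod d) :
    1 ∈ homogeneousCommutant deg A p p :=
  ⟨fun _ _ hij => Matrix.one_apply_ne fun h => hij (by rw [h]), Commute.one_left A⟩

theorem mul_mem_homogeneousCommutant (deg : ι → ZMod d) (A : Matrix ι ι R) (p q r : ZMod d)
    (x : Matrix ι ι R) (hx : x ∈ homogeneousCommutant deg A p q) (y : Matrix ι ι R)
    (hy : y ∈ homogeneousCommutant deg A q r) : x * y ∈ homogeneousCommutant deg A p r := by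
  refine ⟨fun i j hij => Finset.sum_eq_zero fun l _ => ?_, hx.2.mul_left hy.2⟩
  change x i l * y l j = 0
  by_cases h : deg i + p = deg l + q
  · rw [hy.1 l j (fun h' => hij (h.trans h')), mul_zero]
  · rw [hx.1 i l h, zero_mul]

/-- The diagonal matrices which project onto the homogeneous parts, together with `A`. -/
def gradedGenerators (deg : ι → ZMod d) (A : Matrix ι ι R) : Set (Matrix ι ι R) :=
  insert A (Set.range fun m : ZMod d => Matrix.diagonal fun i => if deg i = m then (1 : R) else 0)

/-- Preserving degrees is the same as commuting with the homogeneous projections. This turns graded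
endomorphisms into a commutant, to which the idempotent lifting applies. -/
theorem forall_commute_gradedGenerators_iff {deg : ι → ZMod d} {A h : Matrix ι ι R} :
    (∀ a ∈ gradedGenerators deg A, Commute h a) ↔
      (∀ i j, deg i ≠ deg j → h i j = 0) ∧ Commute h A := by
  rw [gradedGenerators, Set.forall_mem_insert, Set.forall_mem_range, and_comm]
  refine and_congr_left fun _ => ⟨fun H i j hij => ?_, fun H m => ?_⟩
  · have := congrFun (congrFun (H (deg j)).eq i) j
    simpa [hij] using this
  · ext i j
    rw [Matrix.mul_diagonal, Matrix.diagonal_mul]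
    by_cases hij : deg i = deg j
    · rw [hij, mul_comm]
    · rw [H i j hij, zero_mul, mul_zero]

theorem forall_commute_gradedGenerators_iff_mem {deg : ι → ZMod d} {A h : Matrix ι ι R}
    (p : ZMod d) : (∀ a ∈ gradedGenerators deg A, Commute h a) ↔
      h ∈ homogeneousCommutant deg A p p := by
  rw [forall_commute_gradedGenerators_iff, mem_homogeneousCommutant]
  simp only [ne_eq, add_left_inj]

end Homogeneous

/-! ### Idempotents on the sum of all shifts -/

namespace MvPowerSeries

variable {σ k ι : Type*} [Field k] [Fintype ι] [DecidableEq ι] [Nonempty ι] {d : ℕ} [NeZero d]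

/-- Let `A` be the matrix of a graded module without nontrivial idempotent endomorphisms (`H1`)
which is not isomorphic to its shifts (`H2`). Then an idempotent endomorphism of the sum of all
shifts is `0` or `1` modulo the maximal ideal if its diagonal blocks are all congruent. -/
theorem map_blocks_eq_zero_or_one (deg : ι → ZMod d) (A : Matrix ι ι (MvPowerSeries σ k))
    (H1 : ∀ e : Matrix ι ι (MvPowerSeries σ k), IsIdempotentElem e →
      (∀ i j, deg i ≠ deg j → e i j = 0) → Commute e A → e = 0 ∨ e = 1)
    (H2 : ∀ m : ZMod d, m ≠ 0 → ∀ h : Matrix ι ι (MvPowerSeries σ k),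
      (∀ i j, deg i ≠ deg j + m → h i j = 0) → Commute h A → ¬ IsUnit h)
    (M : Matrix (ZMod d) (ZMod d) (Matrix ι ι (MvPowerSeries σ k))) (hM : IsIdempotentElem M)
    (hMG : ∀ p q, M p q ∈ homogeneousCommutant deg A p q)
    (hdiag : ∀ p q, matrixConstantCoeff (M p p) = matrixConstantCoeff (M q q)) :
    matrixConstantCoeff.mapMatrix M = 0 ∨ matrixConstantCoeff.mapMatrix M = 1 := by
  have H1' : ∀ e : Matrix ι ι (MvPowerSeries σ k), IsIdempotentElem e →
      (∀ a ∈ gradedGenerators deg A, Commute e a) → e = 0 ∨ e = 1 := fun e he h =>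
    H1 e he (forall_commute_gradedGenerators_iff.mp h).1 (forall_commute_gradedGenerators_iff.mp h).2
  -- If the product were a unit, determinants would make `x` itself a unit, of nonzero degree q - p,
  -- against `H2`.
  have hoff : ∀ p q, p ≠ q → ∀ x ∈ homogeneousCommutant deg A p q,
      ∀ y : Matrix ι ι (MvPowerSeries σ k), ¬ IsUnit (x * y) := by
    intro p q hpq x hx y hu
    refine H2 (q - p) (sub_ne_zero.mpr hpq.symm) x (fun i j hij => hx.1 i j fun h => hij ?_) hx.2 ?_
    · rw [← add_sub_assoc, ← h, add_sub_cancel_right]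
    · rw [Matrix.isUnit_iff_isUnit_det, Matrix.det_mul] at hu
      exact (Matrix.isUnit_iff_isUnit_det _).mpr (isUnit_of_mul_isUnit_left hu)
  -- The diagonal entry (yM)_{pp} is the sum of the y_{pq} M_{qp}. The term q = p is a nonunit by
  -- assumption on M_{pp}, the others by `hoff`; so the sum is a nonunit and has nilpotent constant
  -- term.
  have hzero : ∀ M : Matrix (ZMod d) (ZMod d) (Matrix ι ι (MvPowerSeries σ k)),
      IsIdempotentElem M → (∀ p q, M p q ∈ homogeneousCommutant deg A p q) →
      (∀ p, ¬ IsUnit (M p p)) → matrixConstantCoeff.mapMatrix M = 0 := by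
    intro M hM hMG hMu
    refine map_eq_zero_of_isNilpotent_diag _ _ (one_mem_homogeneousCommutant deg A)
      (mul_mem_homogeneousCommutant deg A) M hM hMG fun y hy p => ?_
    have hmem : ∀ q, y p q * M q p ∈ homogeneousCommutant deg A p p := fun q =>
      mul_mem_homogeneousCommutant deg A p q p _ (hy p q) _ (hMG q p)
    refine (isUnit_or_isNilpotent_of_commute (gradedGenerators deg A) H1' _
      ((forall_commute_gradedGenerators_iff_mem p).mpr (sum_mem fun q _ => hmem q))).resolve_left
      (not_isUnit_sum_of_commute (gradedGenerators deg A) H1' _ _ (fun q _ =>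
        (forall_commute_gradedGenerators_iff_mem p).mpr (hmem q)) fun q _ => ?_)
    by_cases hpq : p = q
    · subst hpq
      intro hu
      rw [Matrix.isUnit_iff_isUnit_det, Matrix.det_mul] at hu
      exact hMu p ((Matrix.isUnit_iff_isUnit_det _).mpr (isUnit_of_mul_isUnit_right hu))
    · exact hoff p q hpq _ (hy p q) _
  by_cases h : IsUnit (M 0 0)
  · right
    have hu : ∀ p, IsUnit (M p p) := fun p => by
      rw [isUnit_matrix_iff, hdiag p 0, ← isUnit_matrix_iff]
      exact h
    have h1 : ∀ p q, (1 - M) p q ∈ homogeneousCommutant deg A p q := fun p q =>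
      ((blockSubring (homogeneousCommutant deg A) (one_mem_homogeneousCommutant deg A)
        (mul_mem_homogeneousCommutant deg A)).sub_mem (one_mem _) hMG) p q
    have h2 := hzero (1 - M) hM.one_sub h1 fun p hp => ?_
    · rw [map_sub, map_one, sub_eq_zero] at h2
      exact h2.symm
    -- Reading (1 - M) M = 0 at (p, p) expresses this product through composites passing through
    -- other shifts. Their sum is a nonunit, so (1 - M)_{pp} cannot be a unit along with M_{pp}.
    · have h3 : (1 - M) p p * M p p
          = ∑ q ∈ Finset.univ.erase p, M p q * M q p := by
        have h4 : ((1 - M) * M) p p = 0 := by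
          rw [sub_mul, one_mul, hM.eq, sub_self]; rfl
        rw [Matrix.mul_apply, ← Finset.add_sum_erase _ _ (Finset.mem_univ p)] at h4
        rw [eq_neg_of_add_eq_zero_left h4, ← Finset.sum_neg_distrib]
        refine Finset.sum_congr rfl fun q hq => ?_
        rw [Matrix.sub_apply, Matrix.one_apply_ne (Finset.ne_of_mem_erase hq).symm, zero_sub,
          neg_mul, neg_neg]
      refine not_isUnit_sum_of_commute (gradedGenerators deg A) H1' (Finset.univ.erase p)
        (fun q => M p q * M q p) (fun q _ => (forall_commute_gradedGenerators_iff_mem p).mpr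
          (mul_mem_homogeneousCommutant deg A p q p _ (hMG p q) _ (hMG q p)))
        (fun q hq => hoff p q (Finset.ne_of_mem_erase hq).symm _ (hMG p q) _) ?_
      rw [← h3]
      exact hp.mul (hu p)
  · left
    refine hzero M hM hMG fun p hp => h ?_
    rw [isUnit_matrix_iff, hdiag 0 p, ← isUnit_matrix_iff]
    exact hp

end MvPowerSeries

/-! ### Setting one group of variables to zero -/

namespace MvPowerSeries

theorem constantCoeff_killCompl {σ ρ R : Type*} [CommRing R] (e : σ ↪ ρ)
    (s : MvPowerSeries ρ R) : constantCoeff (killCompl e s) = constantCoeff s := by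
  rw [← coeff_zero_eq_constantCoeff_apply, coeff_killCompl, Finsupp.embDomain_zero,
    coeff_zero_eq_constantCoeff_apply]

/-- A monomial lying in both disjoint groups of variables is 1, so only the constant coefficient
could survive. -/
theorem killCompl_rename_eq_zero {σ τ ρ R : Type*} [CommRing R] (e : σ ↪ ρ) (e' : τ ↪ ρ)
    (hd : ∀ i j, e i ≠ e' j) {s : MvPowerSeries τ R} (hs : constantCoeff s = 0) :
    killCompl e (rename e' s) = 0 := by
  classical
  ext x
  rw [coeff_killCompl, map_zero]
  by_cases hx : Finsupp.embDomain e x ∈ Set.range (Finsupp.mapDomain e')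
  · obtain ⟨y, hy⟩ := hx
    rw [← Finsupp.embDomain_eq_mapDomain] at hy
    have hy0 : y = 0 := by
      ext j
      rw [← Finsupp.embDomain_apply_self e' y j, hy, Finsupp.embDomain_of_notMem_range]
      · rfl
      · rintro ⟨i, hi⟩
        exact hd i j hi
    rw [← hy, coeff_embDomain_rename, hy0, coeff_zero_eq_constantCoeff_apply, hs]
  · exact coeff_rename_eq_zero _ _ hx

end MvPowerSeries

section DisjointVariables

open MvPowerSeries

variable {k : Type u} [Field k] {a b : ℕ}

/-- Setting the variables `y` to zero. -/
noncomputable def killY (k : Type u) [Field k] (a b : ℕ) :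
    MvPowerSeries (Fin a ⊕ Fin b) k →+* MvPowerSeries (Fin a) k :=
  (killCompl (R := k) (Function.Embedding.inl : Fin a ↪ Fin a ⊕ Fin b)).toRingHom

/-- Setting the variables `x` to zero. -/
noncomputable def killX (k : Type u) [Field k] (a b : ℕ) :
    MvPowerSeries (Fin a ⊕ Fin b) k →+* MvPowerSeries (Fin b) k :=
  (killCompl (R := k) (Function.Embedding.inr : Fin b ↪ Fin a ⊕ Fin b)).toRingHom

theorem killY_inclX (s : MvPowerSeries (Fin a) k) : killY k a b (inclX k a b s) = s :=
  killCompl_rename_app (e := (Function.Embedding.inl : Fin a ↪ Fin a ⊕ Fin b)) s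

theorem killX_inclY (s : MvPowerSeries (Fin b) k) : killX k a b (inclY k a b s) = s :=
  killCompl_rename_app (e := (Function.Embedding.inr : Fin b ↪ Fin a ⊕ Fin b)) s

theorem killY_inclY {s : MvPowerSeries (Fin b) k} (hs : constantCoeff s = 0) :
    killY k a b (inclY k a b s) = 0 :=
  killCompl_rename_eq_zero (Function.Embedding.inl : Fin a ↪ Fin a ⊕ Fin b)
    (Function.Embedding.inr : Fin b ↪ Fin a ⊕ Fin b) (fun _ _ => Sum.inl_ne_inr) hs

theorem killX_inclX {s : MvPowerSeries (Fin a) k} (hs : constantCoeff s = 0) :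
    killX k a b (inclX k a b s) = 0 :=
  killCompl_rename_eq_zero (Function.Embedding.inr : Fin b ↪ Fin a ⊕ Fin b)
    (Function.Embedding.inl : Fin a ↪ Fin a ⊕ Fin b) (fun _ _ => Sum.inr_ne_inl) hs

theorem constantCoeff_killY (s : MvPowerSeries (Fin a ⊕ Fin b) k) :
    constantCoeff (killY k a b s) = constantCoeff s := constantCoeff_killCompl _ s

theorem constantCoeff_killX (s : MvPowerSeries (Fin a ⊕ Fin b) k) :
    constantCoeff (killX k a b s) = constantCoeff s := constantCoeff_killCompl _ s

theorem killX_C (c : k) : killX k a b (C c) = C c :=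
  killCompl_C (e := (Function.Embedding.inr : Fin b ↪ Fin a ⊕ Fin b)) c

theorem ZMod.eq_apply_zero_of_forall_sub_one {d : ℕ} [NeZero d] {α : Type*} {F : ZMod d → α}
    (h : ∀ q, F (q - 1) = F q) (q : ZMod d) : F q = F 0 := by
  have key : ∀ n : ℕ, F (n : ZMod d) = F 0 := by
    intro n
    induction n with
    | zero => rw [Nat.cast_zero]
    | succ n ih => rw [← h, Nat.cast_succ, add_sub_cancel_right, ih]
  rw [← ZMod.natCast_zmod_val q]
  exact key _

variable {ι : Type*} [Fintype ι] [DecidableEq ι] [Nonempty ι] {d : ℕ} [NeZero d]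

/-- Indecomposability of the tensor product, in terms of block matrices: here `A` is the matrix
of the first factor, `u` is the second factor, and `M` is an endomorphism of the tensor
product. -/
theorem blocks_eq_zero_or_one {ζ : k} (hζ : ζ ≠ 0) (deg : ι → ZMod d)
    (A : Matrix ι ι (MvPowerSeries (Fin a) k)) (hA : ∀ i j, constantCoeff (A i j) = 0)
    (H1 : ∀ e : Matrix ι ι (MvPowerSeries (Fin a) k), IsIdempotentElem e →
      (∀ i j, deg i ≠ deg j → e i j = 0) → Commute e A → e = 0 ∨ e = 1)
    (H2 : ∀ m : ZMod d, m ≠ 0 → ∀ h : Matrix ι ι (MvPowerSeries (Fin a) k),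
      (∀ i j, deg i ≠ deg j + m → h i j = 0) → Commute h A → ¬ IsUnit h)
    (u : ZMod d → MvPowerSeries (Fin b) k) (hu : ∀ q, constantCoeff (u q) = 0)
    (hu0 : ∀ q, u q ≠ 0)
    (M : Matrix (ZMod d) (ZMod d) (Matrix ι ι (MvPowerSeries (Fin a ⊕ Fin b) k)))
    (hM : IsIdempotentElem M) (hdeg : ∀ p q i j, deg i + p ≠ deg j + q → M p q i j = 0)
    (hcomm : ∀ p q, M p q * (inclX k a b).mapMatrix A
        + inclY k a b (u q) • (M p (q - 1) * Matrix.diagonal fun i => C ζ ^ (deg i).val)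
      = (inclX k a b).mapMatrix A * M p q
        + inclY k a b (u (p + 1)) • ((Matrix.diagonal fun i => C ζ ^ (deg i).val) * M (p + 1) q)) :
    M = 0 ∨ M = 1 := by
  have hAX : (killX k a b).mapMatrix ((inclX k a b).mapMatrix A) = 0 := by
    ext1 i j
    exact killX_inclX (hA i j)
  have hAY : (killY k a b).mapMatrix ((inclX k a b).mapMatrix A) = A := by
    ext1 i j
    exact killY_inclX _
  -- At x = 0 the relation in position (q - 1, q) reduces to u_q M_{q-1,q-1} D = u_q D M_{q,q}.
  -- Entries between equal degrees see the same power of ζ on both sides, and the remaining entries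
  -- vanish.
  have hstep : ∀ q, (killX k a b).mapMatrix (M (q - 1) (q - 1)) = (killX k a b).mapMatrix (M q q) := by
    intro q
    ext1 i j
    by_cases hij : deg i = deg j
    · have h1 := congrArg (fun T => (killX k a b).mapMatrix T i j) (hcomm (q - 1) q)
      simp only [map_add, map_mul, hAX, mul_zero, zero_mul, Matrix.add_apply, Matrix.zero_apply,
        zero_add, sub_add_cancel] at h1
      simp only [RingHom.mapMatrix_apply, Matrix.map_apply, Matrix.smul_apply, smul_eq_mul,
        map_mul, killX_inclY, Matrix.mul_diagonal, Matrix.diagonal_mul, map_pow, killX_C] at h1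
      have h2 := mul_left_cancel₀ (hu0 q) h1
      rw [hij, mul_comm] at h2
      exact mul_left_cancel₀ (pow_ne_zero _ (by simpa using hζ)) h2
    · simp [hdeg _ _ i j (fun h => hij (add_right_cancel h))]
  -- Neither specialization changes constant terms; this carries the equality of diagonal blocks
  -- found at x = 0 over to y = 0.
  have hconst : ∀ T : Matrix ι ι (MvPowerSeries (Fin a ⊕ Fin b) k),
      matrixConstantCoeff ((killY k a b).mapMatrix T) = matrixConstantCoeff T := fun T => by
    ext i j; exact constantCoeff_killY _
  have hconst' : ∀ T : Matrix ι ι (MvPowerSeries (Fin a ⊕ Fin b) k),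
      matrixConstantCoeff ((killX k a b).mapMatrix T) = matrixConstantCoeff T := fun T => by
    ext i j; exact constantCoeff_killX _
  have hdiag : ∀ p q, matrixConstantCoeff ((killY k a b).mapMatrix (M p p))
      = matrixConstantCoeff ((killY k a b).mapMatrix (M q q)) := by
    intro p q
    have h1 := ZMod.eq_apply_zero_of_forall_sub_one
      (F := fun q => (killX k a b).mapMatrix (M q q)) hstep
    rw [hconst, hconst, ← hconst', ← hconst']
    exact congrArg matrixConstantCoeff ((h1 p).trans (h1 q).symm)
  have hmain := map_blocks_eq_zero_or_one deg A H1 H2 ((killY k a b).mapMatrix.mapMatrix M)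
    (by rw [IsIdempotentElem, ← map_mul, hM.eq])
    (fun p q => ⟨fun i j hij => by simp [hdeg p q i j hij], by
      have h1 := congrArg (killY k a b).mapMatrix (hcomm p q)
      have h2 : ∀ (s : MvPowerSeries (Fin a ⊕ Fin b) k) (T : Matrix ι ι _),
          (killY k a b).mapMatrix (s • T) = killY k a b s • (killY k a b).mapMatrix T :=
        fun s T => by ext1 i j; exact map_mul (killY k a b) s (T i j)
      rw [map_add, map_add, h2, h2, killY_inclY (hu q), killY_inclY (hu _), zero_smul, zero_smul,
        add_zero, add_zero, map_mul, map_mul, hAY] at h1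
      exact h1⟩)
    hdiag
  have hconstM : matrixConstantCoeff.mapMatrix ((killY k a b).mapMatrix.mapMatrix M)
      = matrixConstantCoeff.mapMatrix M := by
    ext1 p q; exact hconst _
  rw [hconstM] at hmain
  -- Flattening the blocks gives an ordinary matrix of power series, for which idempotents with zero
  -- constant term vanish.
  have hzero : ∀ N : Matrix (ZMod d) (ZMod d) (Matrix ι ι (MvPowerSeries (Fin a ⊕ Fin b) k)),
      IsIdempotentElem N → matrixConstantCoeff.mapMatrix N = 0 → N = 0 := by
    intro N hN h0
    have h1 : Matrix.compRingEquiv (ZMod d) ι _ N = 0 := by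
      refine eq_zero_of_isIdempotentElem (by rw [IsIdempotentElem, ← map_mul, hN.eq]) ?_
      ext x y
      exact congrFun (congrFun (congrFun (congrFun h0 x.1) y.1) x.2) y.2
    exact (map_eq_zero_iff _ (RingEquiv.injective _)).mp h1
  rcases hmain with h | h
  · exact Or.inl (hzero M hM h)
  · have h1 := hzero (1 - M) hM.one_sub (by rw [map_sub, map_one, h, sub_self])
    exact Or.inr (sub_eq_zero.mp h1).symm

end DisjointVariables

/-! ### Idempotents, shifts and homogeneous bases of matrix factorizations -/

namespace MatFac

section General

variable {Q : Type u} [CommRing Q] {d : ℕ} {f : Q}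

theorem map_proj_comm {X Y : MatFac d f} {c : ZMod d} {e : X.carrier →ₗ[Q] Y.carrier}
    (he : ∀ k, ∀ x ∈ X.gr k, e x ∈ Y.gr (k + c)) (k : ZMod d) (x : X.carrier) :
    e (GradedAux.proj X.isInternal k x) = GradedAux.proj Y.isInternal (k + c) (e x) := by
  have : e ∘ₗ GradedAux.proj X.isInternal k = GradedAux.proj Y.isInternal (k + c) ∘ₗ e := by
    refine GradedAux.ext_of_homogeneous X.isInternal fun i x hx => ?_
    rw [LinearMap.comp_apply, LinearMap.comp_apply]
    by_cases h : k = i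
    · subst h
      rw [GradedAux.proj_same _ hx, GradedAux.proj_same _ (he _ _ hx)]
    · rw [GradedAux.proj_ne _ h hx, map_zero,
        GradedAux.proj_ne _ (fun h' => h (add_right_cancel h')) (he _ _ hx)]
  exact LinearMap.congr_fun this x

theorem map_proj_comm_zero {X Y : MatFac d f} {e : X.carrier →ₗ[Q] Y.carrier}
    (he : ∀ k, ∀ x ∈ X.gr k, e x ∈ Y.gr k) (k : ZMod d) (x : X.carrier) :
    e (GradedAux.proj X.isInternal k x) = GradedAux.proj Y.isInternal k (e x) := by
  have := map_proj_comm (c := 0) (e := e) (fun k x hx => by rw [add_zero]; exact he k x hx) k x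
  rwa [add_zero] at this

variable [NeZero d]

/-- The direct summand of a matrix factorization cut out by an idempotent endomorphism. -/
noncomputable def rangeOfIdempotent (X : MatFac d f) (e : Module.End Q X.carrier)
    (he : IsIdempotentElem e) (hg : ∀ k, ∀ x ∈ X.gr k, e x ∈ X.gr k)
    (hc : ∀ x, e (X.map x) = X.map (e x)) : MatFac d f :=
  have hfix : ∀ x ∈ LinearMap.range e, e x = x := by
    rintro _ ⟨y, rfl⟩
    exact LinearMap.congr_fun he.eq y
  have hmap : ∀ x ∈ LinearMap.range e, X.map x ∈ LinearMap.range e := by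
    rintro _ ⟨y, rfl⟩
    exact ⟨X.map y, hc y⟩
  have hproj : ∀ k, ∀ x ∈ LinearMap.range e, GradedAux.proj X.isInternal k x ∈ LinearMap.range e := by
    rintro k _ ⟨y, rfl⟩
    exact ⟨_, map_proj_comm_zero hg k y⟩
  { carrier := LinearMap.range e
    instProjective := Module.Projective.of_split (LinearMap.range e).subtype e.rangeRestrict
      (LinearMap.ext fun x => Subtype.ext (hfix x x.2))
    gr := fun k => (X.gr k).comap (LinearMap.range e).subtype
    map := X.map.restrict hmap
    isInternal := by
      refine GradedAux.isInternal_of_proj _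
        (fun k => (GradedAux.proj X.isInternal k).restrict (hproj k)) ?_ ?_ ?_ ?_
      · intro k x
        exact GradedAux.proj_mem X.isInternal k x.1
      · intro k x hx
        exact Subtype.ext (GradedAux.proj_same X.isInternal hx)
      · intro k j hkj x hx
        exact Subtype.ext (GradedAux.proj_ne X.isInternal hkj hx)
      · intro x
        refine Subtype.ext ?_
        rw [AddSubmonoidClass.coe_finsetSum]
        exact GradedAux.sum_proj X.isInternal x.1
    map_mem := fun k x hx => X.map_mem k x.1 hx
    map_pow := by
      refine LinearMap.ext fun x => Subtype.ext ?_
      rw [Module.End.pow_restrict]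
      exact LinearMap.congr_fun X.map_pow x.1 }

/-- The images of `e` and 1 - e are matrix factorizations whose direct sum is isomorphic to X, so
one of them is zero. -/
theorem Indecomposable.idempotent_eq_zero_or_one {X : MatFac d f} (hX : X.Indecomposable)
    {e : Module.End Q X.carrier} (he : IsIdempotentElem e)
    (hg : ∀ k, ∀ x ∈ X.gr k, e x ∈ X.gr k) (hc : ∀ x, e (X.map x) = X.map (e x)) :
    e = 0 ∨ e = 1 := by
  have hg' : ∀ k, ∀ x ∈ X.gr k, (1 - e) x ∈ X.gr k := fun k x hx => sub_mem hx (hg k x hx)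
  have hc' : ∀ x, (1 - e) (X.map x) = X.map ((1 - e) x) := fun x => by
    simp [hc]
  have hee : ∀ x, e (e x) = e x := fun x => LinearMap.congr_fun he.eq x
  let Y := rangeOfIdempotent X e he hg hc
  let Z := rangeOfIdempotent X (1 - e) he.one_sub hg' hc'
  let F : X.carrier →ₗ[Q] LinearMap.range e × LinearMap.range (1 - e) :=
    e.rangeRestrict.prod (1 - e).rangeRestrict
  let G : LinearMap.range e × LinearMap.range (1 - e) →ₗ[Q] X.carrier :=
    (LinearMap.range e).subtype.coprod (LinearMap.range (1 - e)).subtype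
  have hGF : G ∘ₗ F = LinearMap.id := LinearMap.ext fun x => by simp [F, G]
  have hFG : F ∘ₗ G = LinearMap.id := by
    refine LinearMap.ext ?_
    rintro ⟨⟨_, y, rfl⟩, ⟨_, z, rfl⟩⟩
    refine Prod.ext (Subtype.ext ?_) (Subtype.ext ?_)
    · simp [F, G, hee]
    · simp [F, G, hee]
  let E : X.carrier ≃ₗ[Q] LinearMap.range e × LinearMap.range (1 - e) :=
    LinearEquiv.ofLinearMap F G hFG hGF
  have hiso : X.Iso (Y.directSum Z) := by
    refine ⟨E, fun k => le_antisymm ?_ ?_, fun x => ?_⟩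
    · rintro _ ⟨x, hx, rfl⟩
      exact ⟨hg k x hx, hg' k x hx⟩
    · rintro y ⟨h1, h2⟩
      refine ⟨G y, add_mem h1 h2, LinearMap.congr_fun hFG y⟩
    · exact Prod.ext (Subtype.ext (hc x)) (Subtype.ext (hc' x))
  rcases hX.2 Y Z hiso with h | h
  · left
    ext x
    have : Subsingleton (LinearMap.range e) := h
    exact congrArg Subtype.val (Subsingleton.elim (e.rangeRestrict x) 0)
  · right
    ext x
    have : Subsingleton (LinearMap.range (1 - e)) := h
    have h1 := congrArg Subtype.val (Subsingleton.elim ((1 - e).rangeRestrict x) 0)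
    exact (sub_eq_zero.mp h1).symm

/-- A decomposition yields the projection onto its first summand; its being 0 or 1 kills one of the
summands. -/
theorem indecomposable_of_idempotent {X : MatFac d f} (h0 : ¬ X.IsZero)
    (h : ∀ e : Module.End Q X.carrier, IsIdempotentElem e → (∀ k, ∀ x ∈ X.gr k, e x ∈ X.gr k) →
      (∀ x, e (X.map x) = X.map (e x)) → e = 0 ∨ e = 1) : X.Indecomposable := by
  refine ⟨h0, fun Y Z ⟨E, hE, hEm⟩ => ?_⟩
  let E' : X.carrier ≃ₗ[Q] Y.carrier × Z.carrier := E
  let e : Module.End Q X.carrier := E'.symm.toLinearMap ∘ₗ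
    (LinearMap.inl Q Y.carrier Z.carrier ∘ₗ LinearMap.fst Q Y.carrier Z.carrier) ∘ₗ E'.toLinearMap
  have hEe : ∀ x, E' (e x) = ((E' x).1, 0) := fun x => by simp [e]
  have hsymm : ∀ k y, y ∈ (Y.directSum Z).gr k → E'.symm y ∈ X.gr k := by
    intro k y hy
    rw [← hE k] at hy
    obtain ⟨x, hx, rfl⟩ := hy
    change E'.symm (E' x) ∈ X.gr k
    rwa [E'.symm_apply_apply]
  have hei : IsIdempotentElem e := by
    refine LinearMap.ext fun x => E'.injective ?_
    rw [Module.End.mul_apply, hEe, hEe]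
  have heg : ∀ k, ∀ x ∈ X.gr k, e x ∈ X.gr k := by
    intro k x hx
    have h1 : E' x ∈ (Y.directSum Z).gr k := by rw [← hE k]; exact ⟨x, hx, rfl⟩
    exact hsymm k ((E' x).1, 0) ⟨h1.1, zero_mem _⟩
  have hec : ∀ x, e (X.map x) = X.map (e x) := by
    intro x
    refine E'.injective ?_
    have h1 : ∀ x, E' (X.map x) = (Y.map (E' x).1, Z.map (E' x).2) := hEm
    rw [hEe, h1, h1, hEe, map_zero]
  rcases h e hei heg hec with he | he
  · left
    refine ⟨fun y y' => ?_⟩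
    have h1 : ∀ y : Y.carrier, y = 0 := fun y => by
      have := hEe (E'.symm (y, 0))
      rw [he, LinearMap.zero_apply, map_zero, E'.apply_symm_apply] at this
      exact (congrArg Prod.fst this).symm
    rw [h1 y, h1 y']
  · right
    refine ⟨fun y y' => ?_⟩
    have h1 : ∀ z : Z.carrier, z = 0 := fun z => by
      have := hEe (E'.symm (0, z))
      rw [he, Module.End.one_apply, E'.apply_symm_apply] at this
      exact congrArg Prod.snd this
    rw [h1 y, h1 y']

/-- An invertible endomorphism which shifts degrees by `c` is an isomorphism with a shift. -/
theorem shift_iso_of_equiv {X : MatFac d f} {c : ZMod d} (e : X.carrier ≃ₗ[Q] X.carrier)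
    (hg : ∀ k, ∀ x ∈ X.gr k, e x ∈ X.gr (k + c)) (hc : ∀ x, e (X.map x) = X.map (e x)) :
    (X.shift (-c)).Iso X := by
  refine ⟨e, fun k => le_antisymm ?_ ?_, hc⟩
  · rintro _ ⟨x, hx, rfl⟩
    have := hg _ x hx
    rwa [neg_add_cancel_right] at this
  · intro y hy
    -- The inverse is not assumed homogeneous, so the preimage of `y` is replaced by its component
    -- of the right degree.
    have h1 := map_proj_comm (X := X) (Y := X) (e := e.toLinearMap) hg (k + -c) (e.symm y)
    rw [neg_add_cancel_right, LinearEquiv.coe_coe, LinearEquiv.apply_symm_apply,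
      GradedAux.proj_same X.isInternal hy] at h1
    exact ⟨GradedAux.proj X.isInternal (k + -c) (e.symm y),
      GradedAux.proj_mem X.isInternal (k + -c) (e.symm y), h1⟩

/-- Each homogeneous part is a direct summand of a finitely generated projective module, hence free
over the local ring; the bases of the parts are then collected. -/
theorem exists_homogeneous_basis [IsLocalRing Q] (X : MatFac d f) :
    ∃ (ι : Type u) (_ : Fintype ι) (_ : DecidableEq ι) (deg : ι → ZMod d)
      (b : Module.Basis ι Q X.carrier), ∀ i, b i ∈ X.gr (deg i) := by
  classical
  have hproj : ∀ k, ∀ x : X.carrier, GradedAux.proj X.isInternal k x ∈ X.gr k :=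
    GradedAux.proj_mem X.isInternal
  have hsplit : ∀ k, (GradedAux.proj X.isInternal k).codRestrict (X.gr k) (hproj k)
      ∘ₗ (X.gr k).subtype = LinearMap.id := fun k =>
    LinearMap.ext fun x => Subtype.ext (GradedAux.proj_same X.isInternal x.2)
  have hfin : ∀ k, Module.Finite Q (X.gr k) := fun k =>
    Module.Finite.of_surjective ((GradedAux.proj X.isInternal k).codRestrict (X.gr k) (hproj k))
      fun x => ⟨x, LinearMap.congr_fun (hsplit k) x⟩
  have hpr : ∀ k, Module.Projective Q (X.gr k) := fun k =>
    Module.Projective.of_split (X.gr k).subtype _ (hsplit k)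
  have hfree : ∀ k, Module.Free Q (X.gr k) := fun k => Module.free_of_flat_of_isLocalRing
  exact ⟨Σ k, Module.Free.ChooseBasisIndex Q (X.gr k), inferInstance, inferInstance, Sigma.fst,
    X.isInternal.collectedBasis fun k => Module.Free.chooseBasis Q (X.gr k),
    X.isInternal.collectedBasis_mem _⟩

end General

section Coordinates

variable {Q : Type u} [CommRing Q] {d : ℕ} {f : Q}

variable {X : MatFac d f} {ι : Type*} [Fintype ι] {deg : ι → ZMod d}
  {b : Module.Basis ι Q X.carrier}

theorem mem_gr_iff_repr (hb : ∀ i, b i ∈ X.gr (deg i)) {k : ZMod d} {x : X.carrier} :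
    x ∈ X.gr k ↔ ∀ i, deg i ≠ k → b.repr x i = 0 := by
  constructor
  · intro hx i hi
    have h1 : (Finsupp.lapply i ∘ₗ b.repr.toLinearMap) ∘ₗ GradedAux.proj X.isInternal k = 0 := by
      refine b.ext fun j => ?_
      by_cases hj : k = deg j
      · have hij : j ≠ i := fun h => hi (h ▸ hj.symm)
        simp [GradedAux.proj_same X.isInternal (hj ▸ hb j : b j ∈ X.gr k), hij]
      · simp [GradedAux.proj_ne X.isInternal hj (hb j)]
    have h2 := LinearMap.congr_fun h1 x
    rw [LinearMap.comp_apply, GradedAux.proj_same X.isInternal hx] at h2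
    exact h2
  · intro h
    rw [← b.sum_repr x]
    refine sum_mem fun i _ => ?_
    by_cases hi : deg i = k
    · exact Submodule.smul_mem _ _ (hi ▸ hb i)
    · rw [h i hi, zero_smul]; exact zero_mem _

theorem forall_map_mem_gr_iff [DecidableEq ι] (hb : ∀ i, b i ∈ X.gr (deg i)) {c : ZMod d}
    {e : Module.End Q X.carrier} : (∀ k, ∀ x ∈ X.gr k, e x ∈ X.gr (k + c)) ↔
      ∀ i j, deg i ≠ deg j + c → LinearMap.toMatrixAlgEquiv b e i j = 0 := by
  constructor
  · intro h i j hij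
    rw [LinearMap.toMatrixAlgEquiv_apply]
    exact (mem_gr_iff_repr hb).mp (h _ _ (hb j)) i hij
  · intro h k x hx
    rw [← b.sum_repr x, map_sum]
    refine sum_mem fun j _ => ?_
    rw [map_smul]
    by_cases hj : deg j = k
    · refine Submodule.smul_mem _ _ ((mem_gr_iff_repr hb).mpr fun i hi => ?_)
      rw [← LinearMap.toMatrixAlgEquiv_apply]
      exact h i j (hj ▸ hi)
    · rw [(mem_gr_iff_repr hb).mp hx j hj, zero_smul]; exact zero_mem _

end Coordinates

end MatFac

/-! ### Matrices of scalar extensions, rank one factorizations and tensor products -/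

namespace MatFac

section Bases

variable {Q : Type u} [CommRing Q] {d : ℕ} [NeZero d]

theorem exists_basis_baseChange {Q' : Type u} [CommRing Q'] (ρ : Q →+* Q') {f : Q}
    (X : MatFac d f) {ι : Type*} [Fintype ι] [DecidableEq ι] {deg : ι → ZMod d}
    (b : Module.Basis ι Q X.carrier) (hb : ∀ i, b i ∈ X.gr (deg i)) :
    ∃ b' : Module.Basis ι Q' (X.baseChange ρ).carrier,
      (∀ i, b' i ∈ (X.baseChange ρ).gr (deg i)) ∧
      LinearMap.toMatrixAlgEquiv b' (X.baseChange ρ).map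
        = ρ.mapMatrix (LinearMap.toMatrixAlgEquiv b X.map) := by
  let _ : Algebra Q Q' := ρ.toAlgebra
  let b' : Module.Basis ι Q' (Q' ⊗[Q] X.carrier) := b.baseChange Q'
  have hb' : ∀ i, b' i = 1 ⊗ₜ[Q] b i := fun i => Module.Basis.baseChange_apply Q' b i
  refine ⟨b', fun i => ?_, ?_⟩
  · have h : (1 : Q') ⊗ₜ[Q] b i ∈ (X.gr (deg i)).baseChange Q' :=
      Submodule.tmul_mem_baseChange_of_mem 1 (hb i)
    rw [← hb'] at h
    exact h
  · have h : LinearMap.toMatrixAlgEquiv b' (X.map.baseChange Q')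
        = ρ.mapMatrix (LinearMap.toMatrixAlgEquiv b X.map) := by
      ext i j
      rw [LinearMap.toMatrixAlgEquiv_apply, hb', LinearMap.baseChange_tmul, RingHom.mapMatrix_apply,
        Matrix.map_apply, LinearMap.toMatrixAlgEquiv_apply]
      simp [b', RingHom.algebraMap_toAlgebra, Algebra.smul_def]
    exact h

theorem exists_basis_rankOne (u : ZMod d → Q) :
    ∃ b : Module.Basis (ZMod d) Q (rankOne u).carrier, (∀ q, b q ∈ (rankOne u).gr q) ∧
      LinearMap.toMatrixAlgEquiv b (rankOne u).map
        = Matrix.of fun p q => if p = q - 1 then u q else 0 := by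
  let F : Module.End Q (ZMod d → Q) := (rankOne u).map
  have h : LinearMap.toMatrixAlgEquiv (Pi.basisFun Q (ZMod d)) F
      = Matrix.of fun p q => if p = q - 1 then u q else 0 := by
    ext p q
    rw [LinearMap.toMatrixAlgEquiv_apply, Pi.basisFun_repr, Pi.basisFun_apply]
    change u (p + 1) * (Pi.single q 1 : ZMod d → Q) (p + 1) = _
    by_cases h : p = q - 1
    · subst h; simp
    · have h' : p + 1 ≠ q := fun h' => h (by rw [← h']; ring)
      simp [h, h']
  exact ⟨Pi.basisFun Q (ZMod d), fun q => ⟨1, (Pi.basisFun_apply Q (ZMod d) q).symm⟩, h⟩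

/-- The index of the second factor comes first, so that the outer blocks follow the basis of Y and
each block acts on the basis of X. -/
theorem exists_basis_tensor [NoZeroDivisors Q] {ζ : Q} (hζ : IsPrimitiveRoot ζ d) {f g : Q}
    (X : MatFac d f) (Y : MatFac d g) {ι κ : Type*} [Fintype ι] [DecidableEq ι] [Fintype κ]
    [DecidableEq κ] {deg : ι → ZMod d} {deg' : κ → ZMod d}
    (b : Module.Basis ι Q X.carrier) (hb : ∀ i, b i ∈ X.gr (deg i))
    (c : Module.Basis κ Q Y.carrier) (hc : ∀ i, c i ∈ Y.gr (deg' i)) :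
    ∃ β : Module.Basis (κ × ι) Q (tensor ζ hζ X Y).carrier,
      (∀ x, β x ∈ (tensor ζ hζ X Y).gr (deg x.2 + deg' x.1)) ∧
      (Matrix.compRingEquiv κ ι Q).symm (LinearMap.toMatrixAlgEquiv β (tensor ζ hζ X Y).map)
        = Matrix.of fun p q => (if p = q then LinearMap.toMatrixAlgEquiv b X.map else 0)
          + LinearMap.toMatrixAlgEquiv c Y.map p q •
            Matrix.diagonal fun i => ζ ^ (deg i).val := by
  let β : Module.Basis (κ × ι) Q (X.carrier ⊗[Q] Y.carrier) :=
    (b.tensorProduct c).reindex (Equiv.prodComm ι κ)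
  have hβ : ∀ x, β x = b x.2 ⊗ₜ c x.1 := fun x => by
    rw [Module.Basis.reindex_apply]
    exact Module.Basis.tensorProduct_apply b c x.2 x.1
  refine ⟨β, fun x => ?_, ?_⟩
  · have h := tmul_mem_tensorGr (rfl : deg x.2 + deg' x.1 = _) (hb x.2) (hc x.1)
    rw [← hβ] at h
    exact h
  · have h : (Matrix.compRingEquiv κ ι Q).symm (LinearMap.toMatrixAlgEquiv β (tensorMap ζ X Y))
        = Matrix.of fun p q => (if p = q then LinearMap.toMatrixAlgEquiv b X.map else 0)
          + LinearMap.toMatrixAlgEquiv c Y.map p q •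
            Matrix.diagonal fun i => ζ ^ (deg i).val := by
      ext p q i j
      change LinearMap.toMatrixAlgEquiv β (tensorMap ζ X Y) (p, i) (q, j) = _
      rw [LinearMap.toMatrixAlgEquiv_apply, hβ, tensorMap_tmul ζ X Y (deg j) _ (hb j),
        Module.Basis.repr_reindex_apply]
      change (b.tensorProduct c).repr _ (i, p) = _
      rw [Matrix.of_apply, Matrix.add_apply, Matrix.smul_apply, LinearMap.toMatrixAlgEquiv_apply]
      by_cases hpq : p = q <;> by_cases hij : i = j <;>
        simp [hpq, hij, LinearMap.toMatrixAlgEquiv_apply, mul_comm]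
    exact h

theorem indecomposable_of_blocks [Nontrivial Q] {g : Q} (Z : MatFac d g) {ι : Type*} [Fintype ι]
    [DecidableEq ι] [Nonempty ι] {deg : ι → ZMod d} (β : Module.Basis (ZMod d × ι) Q Z.carrier)
    (hβ : ∀ x, β x ∈ Z.gr (deg x.2 + x.1))
    (H : ∀ M : Matrix (ZMod d) (ZMod d) (Matrix ι ι Q), IsIdempotentElem M →
      (∀ p q i j, deg i + p ≠ deg j + q → M p q i j = 0) →
      Commute M ((Matrix.compRingEquiv (ZMod d) ι Q).symm (LinearMap.toMatrixAlgEquiv β Z.map)) →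
      M = 0 ∨ M = 1) : Z.Indecomposable := by
  let T : Module.End Q Z.carrier ≃+* Matrix (ZMod d) (ZMod d) (Matrix ι ι Q) :=
    (LinearMap.toMatrixAlgEquiv β).toRingEquiv.trans (Matrix.compRingEquiv (ZMod d) ι Q).symm
  refine indecomposable_of_idempotent ?_ fun e he heg hec => ?_
  · intro (h : Subsingleton Z.carrier)
    obtain ⟨i⟩ := ‹Nonempty ι›
    exact β.ne_zero (0, i) (Subsingleton.elim _ _)
  · refine (H (T e) (he.map T) (fun p q i j hij => ?_)
      (Commute.map (LinearMap.ext hec : Commute e Z.map) T)).imp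
      (fun h => T.injective (h.trans (map_zero T).symm))
      (fun h => T.injective (h.trans (map_one T).symm))
    have h1 := (forall_map_mem_gr_iff hβ (c := 0) (e := e)).mp (by simpa using heg) (p, i) (q, j)
    exact h1 (by simpa using hij)

end Bases

theorem repr_map_mem_maximalIdeal {Q : Type u} [CommRing Q] [IsLocalRing Q] {d : ℕ} [NeZero d]
    {f : Q} {X : MatFac d f} (hX : X.IsReduced) {ι : Type*} {deg : ι → ZMod d}
    {b : Module.Basis ι Q X.carrier} (hb : ∀ i, b i ∈ X.gr (deg i)) (i j : ι) :
    b.repr (X.map (b j)) i ∈ IsLocalRing.maximalIdeal Q := by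
  have h1 : X.map (b j) ∈ IsLocalRing.maximalIdeal Q • X.gr (deg j - 1) :=
    hX (deg j) ⟨b j, hb j, rfl⟩
  refine Submodule.smul_induction_on h1 (fun r hr n _ => ?_) fun x y hx hy => ?_
  · rw [map_smul, Finsupp.smul_apply, smul_eq_mul]
    exact Ideal.mul_mem_right _ _ hr
  · rw [map_add, Finsupp.add_apply]
    exact add_mem hx hy

end MatFac

theorem MvPowerSeries.mem_maximalIdeal_iff {σ k : Type*} [Field k] {s : MvPowerSeries σ k} :
    s ∈ IsLocalRing.maximalIdeal (MvPowerSeries σ k) ↔ constantCoeff s = 0 := by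
  rw [IsLocalRing.mem_maximalIdeal, mem_nonunits_iff, isUnit_iff_constantCoeff, isUnit_iff_ne_zero,
    not_not]

/-! ### Indecomposability of the tensor product -/

theorem theorem5p8 {k : Type u} [Field k] (d : ℕ) [NeZero d] (hd : 2 ≤ d)
    (ζ : k) (hζ : IsPrimitiveRoot ζ d) (a b : ℕ)
    (f : MvPowerSeries (Fin a) k) (hf0 : f ≠ 0) (hfu : ¬ IsUnit f)
    (u : ZMod d → MvPowerSeries (Fin b) k) (hu0 : ∏ i, u i ≠ 0)
    (hY : (MatFac.rankOne u).IsReduced)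
    (X : MatFac d f) (hXred : X.IsReduced) (hXind : X.Indecomposable)
    (hXT : ∀ i : ZMod d, i ≠ 0 → ¬ (X.shift i).Iso X) :
    (disjointTensor ζ hζ X (MatFac.rankOne u)).Indecomposable := by
  obtain ⟨ι, _, _, deg, bX, hbX⟩ := X.exists_homogeneous_basis
  have hne : Nonempty ι := by
    by_contra h
    rw [not_nonempty_iff] at h
    exact hXind.1 (bX.repr.toEquiv.subsingleton)
  obtain ⟨bY, hbY, hmY⟩ := MatFac.exists_basis_rankOne u
  obtain ⟨bX', hbX', hmX'⟩ := MatFac.exists_basis_baseChange (inclX k a b) X bX hbX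
  obtain ⟨bY', hbY', hmY'⟩ :=
    MatFac.exists_basis_baseChange (inclY k a b) (MatFac.rankOne u) bY hbY
  obtain ⟨β, hβ, hmβ⟩ := MatFac.exists_basis_tensor (isPrimitiveRoot_C hζ)
    (X.baseChange (inclX k a b)) ((MatFac.rankOne u).baseChange (inclY k a b)) bX' hbX' bY' hbY'
  rw [hmX', hmY', hmY] at hmβ
  let A := LinearMap.toMatrixAlgEquiv bX X.map
  have hmem : ∀ {h : Module.End _ X.carrier}, (∀ x, h (X.map x) = X.map (h x)) ↔
      Commute (LinearMap.toMatrixAlgEquiv bX h) A := by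
    intro h
    rw [commute_iff_eq, ← map_mul, ← map_mul, (LinearMap.toMatrixAlgEquiv bX).injective.eq_iff]
    exact ⟨fun H => LinearMap.ext H, fun H x => LinearMap.congr_fun H x⟩
  refine MatFac.indecomposable_of_blocks (MatFac.tensor (MvPowerSeries.C ζ) (isPrimitiveRoot_C hζ)
    (X.baseChange (inclX k a b)) ((MatFac.rankOne u).baseChange (inclY k a b))) β hβ
    fun M hM hMdeg hMcomm => ?_
  rw [hmβ] at hMcomm
  refine blocks_eq_zero_or_one (hζ.ne_zero (NeZero.ne d)) deg A ?_ ?_ ?_ u ?_ ?_ M hM hMdeg ?_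
  · intro i j
    rw [← MvPowerSeries.mem_maximalIdeal_iff]
    change LinearMap.toMatrixAlgEquiv bX X.map i j ∈ _
    rw [LinearMap.toMatrixAlgEquiv_apply]
    exact MatFac.repr_map_mem_maximalIdeal hXred hbX i j
  · intro h hh hdeg hcomm
    obtain ⟨h, rfl⟩ := (LinearMap.toMatrixAlgEquiv bX).surjective h
    have hi : IsIdempotentElem h := by
      rw [IsIdempotentElem, ← map_mul] at hh
      exact (LinearMap.toMatrixAlgEquiv bX).injective hh
    have h1 := (MatFac.forall_map_mem_gr_iff hbX (c := 0) (e := h)).mpr (by simpa using hdeg)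
    simp only [add_zero] at h1
    refine (hXind.idempotent_eq_zero_or_one hi h1 (hmem.mpr hcomm)).imp ?_ ?_
    · rintro rfl; exact map_zero _
    · rintro rfl; exact map_one _
  · intro m hm h hdeg hcomm hu
    obtain ⟨h, rfl⟩ := (LinearMap.toMatrixAlgEquiv bX).surjective h
    have hu' : IsUnit h := (MulEquiv.isUnit_map (LinearMap.toMatrixAlgEquiv bX)).mp hu
    have h1 := (MatFac.forall_map_mem_gr_iff hbX (c := m) (e := h)).mpr hdeg
    -- An automorphism raising degrees by m identifies T^{-m} X with X.
    exact hXT (-m) (neg_ne_zero.mpr hm) (MatFac.shift_iso_of_equiv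
      (LinearEquiv.ofBijective h ((Module.End.isUnit_iff h).mp hu')) h1 (hmem.mpr hcomm))
  · intro q
    -- The element u_q is the entry (q - 1, q) of the matrix of ψ.
    have h1 := MatFac.repr_map_mem_maximalIdeal hY hbY (q - 1) q
    rw [← LinearMap.toMatrixAlgEquiv_apply, hmY, Matrix.of_apply, if_pos rfl,
      MvPowerSeries.mem_maximalIdeal_iff] at h1
    exact h1
  · intro q
    exact Finset.prod_ne_zero_iff.mp hu0 q (Finset.mem_univ q)
  · intro p q
    -- This puts the condition in the form that selects one summand: right multiplication by the
    -- structure matrix picks column q - 1 of M, left multiplication picks row p + 1.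
    have hshift : ∀ x, p = x - 1 ↔ x = p + 1 := fun x => by rw [eq_sub_iff_add_eq, eq_comm]
    have h1 := congrFun (congrFun hMcomm.eq p) q
    rw [Matrix.mul_apply, Matrix.mul_apply] at h1
    simp only [Matrix.of_apply, RingHom.mapMatrix_apply, Matrix.map_apply, mul_add, add_mul,
      Finset.sum_add_distrib, mul_ite, ite_mul, mul_zero, zero_mul, Finset.sum_ite_eq,
      Finset.sum_ite_eq', Finset.mem_univ, if_true, apply_ite (inclY k a b), map_zero, ite_smul,
      zero_smul, mul_smul_comm, smul_mul_assoc] at h1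
    simp only [hshift, Finset.sum_ite_eq', Finset.mem_univ, if_true] at h1
    exact h1
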